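/- Let $G$ be a torsion-free CSA group (that is, every maximal abelian subgroup $M$ of $G$ is malnormal: $M\cap gMg^{-1}=1$ for all $g\in G\setminus M$), and let $A$ be a subgroup of $G$. Let $\Lambda$ be an abelian splitting of $G$ relative to $A$: a (possibly infinite) connected graph of groups with abelian edge groups, a maximal subtree $T$ of the underlying graph, and an isomorphism from $G$ to the fundamental group of this graph of groups relative to $T$, such that $A$ is contained in a conjugate of a vertex group. Suppose that the image of each edge group in the vertex group at each of its endpoints is a maximal abelian subgroup of that vertex group. If $G$ is infinite cyclic, suppose moreover that the edge groups of $\Lambda$ are nontrivial. Let $G(A)$ be any vertex group of $\Lambda$, or any conjugate in $G$ of a vertex group, that contains $A$. Then $\mathrm{racl}(A)\subseteq G(A)$, and in particular $\mathrm{acl}(A)\subseteq G(A)$. Here $\mathrm{racl}(A)$ is the set of $x\in G$ whose orbit $\{f(x) : f\in \mathrm{Aut}(G),\ f|_A=\mathrm{id}_A\}$ is finite, and $\mathrm{acl}(A)$ is the set of $x\in G$ that belong to some finite subset of $G$ definable by a first-order formula in the language of groups with parameters from $A$. -/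

import Mathlib

/-! ### Torsion-free and CSA groups -/

/-- A group is torsion-free if no nontrivial element has finite order. -/
def IsTorsionFreeGroup (G : Type*) [Group G] : Prop :=
  ∀ g : G, g ≠ 1 → ¬ IsOfFinOrder g

/-- The conjugate subgroup `g H g⁻¹`. -/
def conjSubgroup {G : Type*} [Group G] (g : G) (H : Subgroup G) : Subgroup G :=
  H.map (MulAut.conj g).toMonoidHom

/-- `H` is a maximal abelian subgroup of `G`. -/
def IsMaximalAbelian {G : Type*} [Group G] (H : Subgroup G) : Prop :=
  Maximal (fun K : Subgroup G => IsMulCommutative K) H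

/-- `H` is malnormal in `G`: `H ∩ g H g⁻¹ = 1` for every `g ∉ H`. -/
def IsMalnormal {G : Type*} [Group G] (H : Subgroup G) : Prop :=
  ∀ g : G, g ∉ H → H ⊓ conjSubgroup g H = ⊥

/-- A group is CSA if every maximal abelian subgroup is malnormal. -/
def IsCSA (G : Type*) [Group G] : Prop :=
  ∀ H : Subgroup G, IsMaximalAbelian H → IsMalnormal H

/-! ### Graphs of groups and splittings -/

universe u₁ u₂ u₃ u₄

/-- A graph of groups. An element `e` of `E` is a geometric edge together with a choice of
orientation, from `src e` to `tgt e`; loops and multiple edges are allowed, and the graph may be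
infinite. The edge group embeds in the vertex groups at both endpoints. -/
structure GraphOfGroups where
  /-- the vertices -/
  V : Type u₁
  /-- the (oriented) edges -/
  E : Type u₂
  /-- the initial vertex of an edge -/
  src : E → V
  /-- the terminal vertex of an edge -/
  tgt : E → V
  /-- the vertex groups -/
  vertexGroup : V → Type u₃
  /-- the edge groups -/
  edgeGroup : E → Type u₄
  [vertexGroupInst : ∀ v, Group (vertexGroup v)]
  [edgeGroupInst : ∀ e, Group (edgeGroup e)]
  /-- the embedding of an edge group in the vertex group at the initial vertex -/
  srcHom : ∀ e, edgeGroup e →* vertexGroup (src e)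
  /-- the embedding of an edge group in the vertex group at the terminal vertex -/
  tgtHom : ∀ e, edgeGroup e →* vertexGroup (tgt e)
  srcHom_injective : ∀ e, Function.Injective (srcHom e)
  tgtHom_injective : ∀ e, Function.Injective (tgtHom e)

attribute [instance] GraphOfGroups.vertexGroupInst GraphOfGroups.edgeGroupInst

namespace GraphOfGroups

variable (𝒢 : GraphOfGroups.{u₁, u₂, u₃, u₄})

/-- The unordered pair of endpoints of an edge. -/
def ends (e : 𝒢.E) : Sym2 𝒢.V :=
  s(𝒢.src e, 𝒢.tgt e)

/-- The set `T` of edges, together with all the vertices, is a maximal subtree of the underlying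
graph: it contains no loop and no multiple edge, and the simple graph on the set of all vertices
that it determines is a tree. In particular the underlying graph is nonempty and connected. -/
structure IsMaximalSubtree (T : Set 𝒢.E) : Prop where
  no_loop : ∀ e ∈ T, 𝒢.src e ≠ 𝒢.tgt e
  no_multiple : Set.InjOn 𝒢.ends T
  isTree : (SimpleGraph.fromEdgeSet (𝒢.ends '' T)).IsTree

/-- The free product of the vertex groups and of the free group on the edges. -/
abbrev FreeProd : Type _ :=
  Monoid.Coprod (Monoid.CoprodI 𝒢.vertexGroup) (FreeGroup 𝒢.E)

/-- The inclusion of a vertex group in the free product. -/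
def freeVertex (v : 𝒢.V) : 𝒢.vertexGroup v →* 𝒢.FreeProd :=
  Monoid.Coprod.inl.comp Monoid.CoprodI.of

/-- The stable letter of an edge in the free product. -/
def freeEdge (e : 𝒢.E) : 𝒢.FreeProd :=
  Monoid.Coprod.inr (FreeGroup.of e)

/-- The relators of the fundamental group relative to `T`, expressing
`t_e * tgtHom e c * t_e⁻¹ = srcHom e c` for each edge `e` and each `c` in its edge group, and
`t_e = 1` for each edge `e` in `T`. -/
def relators (T : Set 𝒢.E) : Set 𝒢.FreeProd :=
  {x | ∃ (e : 𝒢.E) (c : 𝒢.edgeGroup e),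
      x = 𝒢.freeEdge e * 𝒢.freeVertex (𝒢.tgt e) (𝒢.tgtHom e c) * (𝒢.freeEdge e)⁻¹ *
        (𝒢.freeVertex (𝒢.src e) (𝒢.srcHom e c))⁻¹} ∪
  {x | ∃ e ∈ T, x = 𝒢.freeEdge e}

/-- The fundamental group of the graph of groups relative to the maximal subtree `T`. -/
abbrev FundamentalGroup (T : Set 𝒢.E) : Type _ :=
  𝒢.FreeProd ⧸ Subgroup.normalClosure (𝒢.relators T)

/-- The canonical homomorphism from a vertex group to the fundamental group. -/
def ofVertex (T : Set 𝒢.E) (v : 𝒢.V) : 𝒢.vertexGroup v →* 𝒢.FundamentalGroup T :=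
  (QuotientGroup.mk' (Subgroup.normalClosure (𝒢.relators T))).comp (𝒢.freeVertex v)

end GraphOfGroups

/-- A splitting of `G`: a graph of groups, a maximal subtree `T` of the underlying graph, and an
isomorphism from `G` to the fundamental group of the graph of groups relative to `T`. -/
structure Splitting (G : Type*) [Group G] where
  /-- the graph of groups -/
  graph : GraphOfGroups.{u₁, u₂, u₃, u₄}
  /-- the edges of the maximal subtree -/
  tree : Set graph.E
  isMaximalSubtree : graph.IsMaximalSubtree tree
  /-- the identification of `G` with the fundamental group -/
  iso : G ≃* graph.FundamentalGroup tree

namespace Splitting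

variable {G : Type*} [Group G] (Λ : Splitting.{u₁, u₂, u₃, u₄} G)

/-- The vertex group at `v`, as a subgroup of `G`. -/
def vertexSubgroup (v : Λ.graph.V) : Subgroup G :=
  (Λ.iso.symm.toMonoidHom.comp (Λ.graph.ofVertex Λ.tree v)).range

/-- A subgroup is elliptic if it lies in a conjugate of a vertex group. -/
def IsElliptic (H : Subgroup G) : Prop :=
  ∃ (v : Λ.graph.V) (g : G), H ≤ conjSubgroup g (Λ.vertexSubgroup v)

/-- `Λ` is an abelian splitting relative to `H`: every edge group is abelian and `H` is
elliptic. -/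
structure IsAbelianRelativeTo (H : Subgroup G) : Prop where
  abelian : ∀ e, IsMulCommutative (Λ.graph.edgeGroup e)
  elliptic : Λ.IsElliptic H

/-- Each edge group is maximal abelian in the vertex groups at both of its endpoints. -/
def EdgeGroupsMaximalAbelian : Prop :=
  ∀ e, IsMaximalAbelian (Λ.graph.srcHom e).range ∧ IsMaximalAbelian (Λ.graph.tgtHom e).range

end Splitting

/-! ### Algebraic closure and restricted algebraic closure in groups -/

/-- The function symbols of the language of groups. -/
inductive GroupFunc : ℕ → Type
  | one : GroupFunc 0
  | inv : GroupFunc 1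
  | mul : GroupFunc 2

/-- The first-order language of groups. -/
def groupLanguage : FirstOrder.Language where
  Functions := GroupFunc
  Relations := fun _ => Empty

/-- A group as a structure in the language of groups. -/
instance groupStructure (G : Type*) [Group G] : groupLanguage.Structure G where
  funMap := fun f x =>
    match f, x with
    | GroupFunc.one, _ => 1
    | GroupFunc.inv, x => (x 0)⁻¹
    | GroupFunc.mul, x => x 0 * x 1
  RelMap := fun r _ => r.elim

/-- The algebraic closure of `A` in the group `G`: the elements of the finite sets that are
definable by a first-order formula in the language of groups with parameters from `A`. -/
def acl {G : Type*} [Group G] (A : Set G) : Set G :=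
  {x | ∃ S : Set G, A.Definable₁ groupLanguage S ∧ S.Finite ∧ x ∈ S}

/-- The restricted algebraic closure of `A` in the group `G`: the elements with a finite orbit
under the automorphisms of `G` that fix `A` pointwise. -/
def racl {G : Type*} [Group G] (A : Set G) : Set G :=
  {x | {y | ∃ f : G ≃* G, (∀ a ∈ A, f a = a) ∧ f x = y}.Finite}

/-! Automorphisms fixing `A` preserve every set definable over `A`, so acl lies in racl.
Conjugating, and enlarging `A` to a whole vertex group, it suffices to show that an element x
outside the vertex group at v has an infinite orbit under the automorphisms fixing that vertex group
pointwise. These automorphisms will be Dehn twists.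

The computations take place in the path group `FundamentalGroup ∅`, where no stable letter is
killed: it is a multiple HNN extension of the free product of the vertex groups, and the loops at v
in it form a copy of G (`exists_section`). Britton's lemma (`eval_notMem_range_ofBase`) is proved
there by letting the group act on a set of sheets.

Write x as a reduced loop with prefixes U_i and oriented edges a_i, i < n. Choose D ≠ 1 in the
vertex group at v fixing the first edge of the corresponding segment of the Bass-Serre tree, and let
D fix exactly the first r edges in succession. By the CSA property, an element carrying one of these
edges to another commutes with D, and the centralizer of D is abelian. Hence the loops closing up
pairs of inverse letters commute, and a length count in a free group
(`FreeGroup.exists_forall_ne_inv`) gives a letter a_l, l < r, whose inverse does not occur among the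
first r letters. Twisting a_l by the m-th power of the conjugate of D in its edge group multiplies
U_r by D^(mN), where N > 0 counts the occurrences of a_l. If r = n, distinct m give distinct images
by torsion-freeness; if r < n, nontrivial powers of D do not fix the next edge, and Britton's lemma
separates the images (`PathCSA.exists_twist_injective`).

If some edge group is trivial, maximality and connectedness make all vertex groups trivial, so G is
free. A nontrivial element of racl then has a finite conjugacy class, which forces G to be
commutative, hence infinite cyclic: the excluded case. -/

section EquivariantExtension

-- Free permutation actions and extension of partial equivariant bijections.

universe w

/-- The orbit relation of a permutation representation. -/
def permOrbit {C : Type*} [Group C] {X : Type*} (β : C →* Equiv.Perm X) : Setoid X where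
  r x y := ∃ c, β c x = y
  iseqv :=
    { refl := fun x => ⟨1, by simp⟩
      symm := by
        rintro x y ⟨c, rfl⟩
        exact ⟨c⁻¹, by simp⟩
      trans := by
        rintro x y z ⟨c, rfl⟩ ⟨d, rfl⟩
        exact ⟨d * c, by simp⟩ }

/-- A free permutation representation is a product of its set of orbits and the group, with
prescribed base points in finitely many orbits. -/
theorem exists_equiv_orbits_prod {C : Type*} [Group C] {X J : Type*} (β : C →* Equiv.Perm X)
    (hβ : ∀ c x, β c x = x → c = 1) (x : J → X)
    (hx : ∀ i j c, β c (x i) = x j → i = j) :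
    ∃ e : X ≃ Quotient (permOrbit β) × C,
      (∀ c p, e (β c p) = ((e p).1, c * (e p).2)) ∧
      ∀ j, e (x j) = (Quotient.mk (permOrbit β) (x j), 1) := by
  classical
  have hxj : ∀ i j, Quotient.mk (permOrbit β) (x i) = Quotient.mk (permOrbit β) (x j) → i = j := by
    intro i j h
    obtain ⟨c, hc⟩ := Quotient.exact h
    exact hx i j c hc
  -- A choice of base points, one per orbit, forced to be `x j` on the orbit of `x j`.
  let σ : Quotient (permOrbit β) → X := fun q =>
    if h : ∃ j, Quotient.mk (permOrbit β) (x j) = q then x h.choose else q.out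
  have hσ : ∀ q, Quotient.mk (permOrbit β) (σ q) = q := by
    intro q
    by_cases h : ∃ j, Quotient.mk (permOrbit β) (x j) = q
    · simp only [σ, dif_pos h]
      exact h.choose_spec
    · simp only [σ, dif_neg h]
      exact q.out_eq
  have hσx : ∀ j, σ (Quotient.mk (permOrbit β) (x j)) = x j := by
    intro j
    have h : ∃ i, Quotient.mk (permOrbit β) (x i) = Quotient.mk (permOrbit β) (x j) := ⟨j, rfl⟩
    simp only [σ, dif_pos h]
    rw [hxj _ _ h.choose_spec]
  let f : Quotient (permOrbit β) × C → X := fun p => β p.2 (σ p.1)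
  have hf : Function.Bijective f := by
    constructor
    · rintro ⟨q, c⟩ ⟨q', c'⟩ h
      have h' : β c (σ q) = β c' (σ q') := h
      have hq : q = q' := by
        rw [← hσ q, ← hσ q']
        refine Quotient.sound ⟨c'⁻¹ * c, ?_⟩
        rw [map_mul, Equiv.Perm.mul_apply, h', ← Equiv.Perm.mul_apply, ← map_mul]
        simp
      subst hq
      have : c'⁻¹ * c = 1 := by
        apply hβ _ (σ q)
        rw [map_mul, Equiv.Perm.mul_apply, h', ← Equiv.Perm.mul_apply, ← map_mul]
        simp
      rw [inv_mul_eq_one.mp this]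
    · intro p
      obtain ⟨c, hc⟩ := Quotient.exact (hσ (Quotient.mk (permOrbit β) p))
      exact ⟨(Quotient.mk (permOrbit β) p, c), hc⟩
  let e := (Equiv.ofBijective f hf).symm
  refine ⟨e, ?_, ?_⟩
  · intro c p
    rw [Equiv.symm_apply_eq]
    obtain ⟨y, rfl⟩ := (Equiv.ofBijective f hf).surjective p
    simp [e, f]
  · intro j
    rw [Equiv.symm_apply_eq]
    simp [f, hσx]

/-- A partial equivariant bijection between finitely many orbits of two free permutation
representations with the same infinite number of orbits extends to an equivariant bijection. -/
theorem exists_equivariant_extension {C : Type*} [Group C] {X Y : Type w} {J : Type*} [Finite J]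
    (β : C →* Equiv.Perm X) (α : C →* Equiv.Perm Y)
    (hβ : ∀ c x, β c x = x → c = 1) (hα : ∀ c x, α c x = x → c = 1)
    (hcard : Nonempty (Quotient (permOrbit β) ≃ Quotient (permOrbit α)))
    (hinf : Infinite (Quotient (permOrbit β)))
    (x : J → X) (y : J → Y) (hx : ∀ i j c, β c (x i) = x j → i = j)
    (hy : ∀ i j c, α c (y i) = y j → i = j) :
    ∃ τ : X ≃ Y, (∀ c p, τ (β c p) = α c (τ p)) ∧ ∀ j, τ (x j) = y j := by
  classical
  obtain ⟨eX, heX, heXx⟩ := exists_equiv_orbits_prod β hβ x hx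
  obtain ⟨eY, heY, heYy⟩ := exists_equiv_orbits_prod α hα y hy
  have hxj : Function.Injective fun j => Quotient.mk (permOrbit β) (x j) := by
    intro i j h
    obtain ⟨c, hc⟩ := Quotient.exact h
    exact hx i j c hc
  have hyj : Function.Injective fun j => Quotient.mk (permOrbit α) (y j) := by
    intro i j h
    obtain ⟨c, hc⟩ := Quotient.exact h
    exact hy i j c hc
  let s : Set (Quotient (permOrbit β)) := Set.range fun j => Quotient.mk (permOrbit β) (x j)
  have hs : s.Finite := Set.finite_range _
  let e : s ≃ J := (Equiv.ofInjective _ hxj).symm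
  let f : s ↪ Quotient (permOrbit α) :=
    ⟨fun q => Quotient.mk (permOrbit α) (y (e q)), hyj.comp e.injective⟩
  -- A finite partial injection between infinite sets of equal cardinality extends to a bijection,
  -- here between the sets of orbits.
  obtain ⟨g, hg⟩ := Cardinal.extend_function_of_lt f
    (hs.lt_aleph0.trans_le (Cardinal.aleph0_le_mk _)) hcard
  have hg' : ∀ j, g (Quotient.mk (permOrbit β) (x j)) = Quotient.mk (permOrbit α) (y j) := by
    intro j
    have h := hg ⟨Quotient.mk (permOrbit β) (x j), j, rfl⟩
    have he : e ⟨Quotient.mk (permOrbit β) (x j), j, rfl⟩ = j := by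
      rw [Equiv.symm_apply_eq]
      rfl
    simp only [f, Function.Embedding.coeFn_mk, he] at h
    exact h
  refine ⟨eX.trans ((g.prodCongr (Equiv.refl C)).trans eY.symm), ?_, ?_⟩
  · intro c p
    simp only [Equiv.trans_apply, heX]
    rw [Equiv.symm_apply_eq, heY]
    simp
  · intro j
    simp only [Equiv.trans_apply, heXx]
    rw [Equiv.symm_apply_eq, heYy]
    simp [hg']

end EquivariantExtension

/-! ### Permutation representations of multiple HNN extensions. -/

section MultipleHNN

open Cardinal in
/-- The translation action of a subgroup of `K` on `K × (ℕ × K)` has `max ℵ₀ #K` orbits. -/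
theorem mk_quotient_permOrbit_translation {C : Type*} [Group C] {K : Type*} [Group K]
    (β : C →* Equiv.Perm (K × (ℕ × K)))
    (hβ : ∀ c p, (β c p).2 = p.2) :
    #(Quotient (permOrbit β)) = #(ℕ × K) := by
  apply le_antisymm
  · calc #(Quotient (permOrbit β)) ≤ #(K × (ℕ × K)) := mk_quotient_le
      _ ≤ #((ℕ × K) × (ℕ × K)) :=
        mk_le_of_injective (f := fun p => ((0, p.1), p.2)) (by
          rintro ⟨a, b⟩ ⟨c, d⟩ h
          simpa using h)
      _ = #(ℕ × K) := by
        rw [mk_prod (ℕ × K) (ℕ × K), lift_id, mul_eq_self (aleph0_le_mk _)]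
  · refine mk_le_of_injective (f := fun i => Quotient.mk (permOrbit β) (1, i)) ?_
    intro i j h
    obtain ⟨c, hc⟩ := Quotient.exact h
    have := hβ c (1, i)
    rw [hc] at this
    exact this.symm

/-- Left translation on the first factor of `K × I`. -/
def leftTranslation (K I : Type*) [Group K] : K →* Equiv.Perm (K × I) where
  toFun k := (Equiv.mulLeft k).prodCongr (Equiv.refl I)
  map_one' := by ext p <;> simp
  map_mul' a b := by ext p <;> simp [mul_assoc]

@[simp] theorem leftTranslation_apply {K I : Type*} [Group K] (k : K) (p : K × I) :
    leftTranslation K I k p = (k * p.1, p.2) := rfl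

variable {K E : Type*} [Group K] {C : E → Type*} [∀ e, Group (C e)]

/-- The subgroup of the base group of a multiple HNN extension that a stable letter (or its inverse)
conjugates into the base group: the letter `(e, true)` stands for `t_e`, with
`t_e * β e c * t_e⁻¹ = α e c`. -/
def assocSubgroup (α β : ∀ e, C e →* K) (a : E × Bool) : Subgroup K :=
  if a.2 then (β a.1).range else (α a.1).range

/-- Permutations realizing a multiple HNN extension in which a given reduced word moves a sheet. -/
theorem exists_perm_of_reduced (α β : ∀ e, C e →* K) (hα : ∀ e, Function.Injective (α e))
    (hβ : ∀ e, Function.Injective (β e)) (L : List ((E × Bool) × K))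
    (hL : L.IsChain fun x y => y.1 = (x.1.1, !x.1.2) → x.2 ∉ assocSubgroup α β x.1) :
    ∃ τ : E → Equiv.Perm (K × (ℕ × K)),
      (∀ e c, τ e * leftTranslation K (ℕ × K) (β e c) * (τ e)⁻¹ =
        leftTranslation K (ℕ × K) (α e c)) ∧
      (L.map fun x => (if x.1.2 then τ x.1.1 else (τ x.1.1)⁻¹) *
        leftTranslation K (ℕ × K) x.2).prod (1, (L.length, 1)) = (1, (0, 1)) := by
  classical
  -- The i-th syllable is to move the base point of sheet i + 1 to that of sheet i. This prescribes
  -- one value of `τ e`, or of its inverse when the exponent is negative, in which case source and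
  -- target are exchanged.
  let src : Fin L.length → K × (ℕ × K) := fun i =>
    if (L.get i).1.2 then ((L.get i).2, (i.1 + 1, 1)) else (1, (i.1, 1))
  let dst : Fin L.length → K × (ℕ × K) := fun i =>
    if (L.get i).1.2 then (1, (i.1, 1)) else ((L.get i).2, (i.1 + 1, 1))
  have hred : ∀ i j : Fin L.length, j.1 = i.1 + 1 → (L.get j).1.1 = (L.get i).1.1 →
      (L.get j).1.2 = (!(L.get i).1.2) → (L.get i).2 ∉ assocSubgroup α β (L.get i).1 := by
    rintro ⟨i, hi⟩ ⟨j, hj⟩ hij h1 h2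
    simp only at hij
    subst hij
    exact List.isChain_iff_getElem.mp hL i hj (Prod.ext h1 h2)
  have key : ∀ e : E, ∃ τ : Equiv.Perm (K × (ℕ × K)),
      (∀ c p, τ (leftTranslation K (ℕ × K) (β e c) p) =
        leftTranslation K (ℕ × K) (α e c) (τ p)) ∧
      ∀ j : {i : Fin L.length // (L.get i).1.1 = e}, τ (src j) = dst j := by
    intro e
    -- The second factor `K` of the set makes the number of orbits independent of the subgroup
    -- acting, so the two actions of `C e` are equivalent.
    have cardα := mk_quotient_permOrbit_translation
      ((leftTranslation K (ℕ × K)).comp (α e)) (fun _ _ => rfl)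
    have cardβ := mk_quotient_permOrbit_translation
      ((leftTranslation K (ℕ × K)).comp (β e)) (fun _ _ => rfl)
    refine exists_equivariant_extension (J := {i : Fin L.length // (L.get i).1.1 = e})
      ((leftTranslation K (ℕ × K)).comp (β e))
      ((leftTranslation K (ℕ × K)).comp (α e)) ?_ ?_ (Cardinal.eq.mp (cardβ.trans cardα.symm)) ?_
      (fun j => src j.1) (fun j => dst j.1) ?_ ?_
    · rintro c ⟨k, i⟩ h
      have h1 : β e c * k = k := congrArg Prod.fst h
      exact hβ e (by simpa using h1)
    · rintro c ⟨k, i⟩ h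
      have h1 : α e c * k = k := congrArg Prod.fst h
      exact hα e (by simpa using h1)
    · rw [Cardinal.infinite_iff, cardβ]
      exact Cardinal.aleph0_le_mk _
    -- Two prescribed sources can share an orbit only on a common sheet, hence for adjacent
    -- syllables with inverse letters; reducedness excludes exactly this. The targets are treated in
    -- the same way below.
    · rintro ⟨i, hi⟩ ⟨j, hj⟩ c h
      have h12 := Prod.ext_iff.mp h
      rw [Subtype.mk.injEq, Fin.ext_iff]
      rcases hbi : (L.get i).1.2 with _ | _ <;> rcases hbj : (L.get j).1.2 with _ | _ <;>
        simp only [src, hbi, hbj, MonoidHom.comp_apply, leftTranslation_apply, if_true,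
          Bool.false_eq_true, if_false, Prod.mk.injEq, and_true] at h12
      · exact h12.2
      · refine absurd ?_ (hred j i h12.2 (hi.trans hj.symm) (by rw [hbi, hbj]; rfl))
        rw [assocSubgroup, hbj, if_pos rfl, hj]
        exact ⟨c, by rw [← h12.1, mul_one]⟩
      · refine absurd ?_ (hred i j h12.2.symm (hj.trans hi.symm) (by rw [hbi, hbj]; rfl))
        rw [assocSubgroup, hbi, if_pos rfl, hi]
        exact ⟨c⁻¹, by rw [map_inv, inv_eq_of_mul_eq_one_right h12.1]⟩
      · omega
    · rintro ⟨i, hi⟩ ⟨j, hj⟩ c h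
      have h12 := Prod.ext_iff.mp h
      rw [Subtype.mk.injEq, Fin.ext_iff]
      rcases hbi : (L.get i).1.2 with _ | _ <;> rcases hbj : (L.get j).1.2 with _ | _ <;>
        simp only [dst, hbi, hbj, MonoidHom.comp_apply, leftTranslation_apply, if_true,
          Bool.false_eq_true, if_false, Prod.mk.injEq, and_true] at h12
      · omega
      · refine absurd ?_ (hred i j h12.2.symm (hj.trans hi.symm) (by rw [hbi, hbj]; rfl))
        rw [assocSubgroup, hbi, if_neg Bool.false_ne_true, hi]
        exact ⟨c⁻¹, by rw [map_inv, inv_eq_of_mul_eq_one_right h12.1]⟩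
      · refine absurd ?_ (hred j i h12.2 (hi.trans hj.symm) (by rw [hbi, hbj]; rfl))
        rw [assocSubgroup, hbj, if_neg Bool.false_ne_true, hj]
        exact ⟨c, by rw [← h12.1, mul_one]⟩
      · exact h12.2
  choose τ hτ hτj using key
  refine ⟨τ, ?_, ?_⟩
  · intro e c
    ext1 p
    simp only [Equiv.Perm.mul_apply, hτ]
    simp
  · have step : ∀ n m : ℕ, m + n = L.length →
        ((L.drop m).map fun x => (if x.1.2 then τ x.1.1 else (τ x.1.1)⁻¹) *
          leftTranslation K (ℕ × K) x.2).prod (1, (L.length, 1)) = (1, (m, 1)) := by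
      intro n
      induction n with
      | zero =>
        intro m hm
        rw [List.drop_of_length_le (by omega), show m = L.length by omega]
        simp
      | succ n ih =>
        intro m hm
        have hlt : m < L.length := by omega
        rw [List.drop_eq_getElem_cons hlt, List.map_cons, List.prod_cons, Equiv.Perm.mul_apply,
          ih (m + 1) (by omega), Equiv.Perm.mul_apply, leftTranslation_apply]
        have h := hτj _ ⟨⟨m, hlt⟩, rfl⟩
        simp only [src, dst, List.get_eq_getElem] at h
        split_ifs at h ⊢ with hb
        · simpa using h
        · rw [Equiv.Perm.inv_eq_iff_eq, h]
          simp
    simpa using step L.length 0 (by omega)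

end MultipleHNN

namespace GraphOfGroups

/-! ### Universal property and generators of the fundamental group. -/

section UniversalProperty

variable (𝒢 : GraphOfGroups.{u₁, u₂, u₃, u₄}) (T : Set 𝒢.E)

/-- The image of a stable letter in the fundamental group. -/
def edgeElt (e : 𝒢.E) : 𝒢.FundamentalGroup T :=
  QuotientGroup.mk' (Subgroup.normalClosure (𝒢.relators T)) (𝒢.freeEdge e)

theorem edgeElt_conj (e : 𝒢.E) (c : 𝒢.edgeGroup e) :
    𝒢.edgeElt T e * 𝒢.ofVertex T (𝒢.tgt e) (𝒢.tgtHom e c) * (𝒢.edgeElt T e)⁻¹ =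
      𝒢.ofVertex T (𝒢.src e) (𝒢.srcHom e c) := by
  rw [← mul_inv_eq_one]
  have h := (QuotientGroup.eq_one_iff (N := Subgroup.normalClosure (𝒢.relators T)) _).mpr
    (Subgroup.subset_normalClosure (Or.inl ⟨e, c, rfl⟩))
  exact h

theorem edgeElt_eq_one {e : 𝒢.E} (he : e ∈ T) : 𝒢.edgeElt T e = 1 :=
  (QuotientGroup.eq_one_iff (N := Subgroup.normalClosure (𝒢.relators T)) _).mpr
    (Subgroup.subset_normalClosure (Or.inr ⟨e, he, rfl⟩))

variable {𝒢 T}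

/-- The universal property of the fundamental group of a graph of groups. -/
def liftHom {H : Type*} [Group H] (f : ∀ v, 𝒢.vertexGroup v →* H) (t : 𝒢.E → H)
    (hrel : ∀ e c, t e * f (𝒢.tgt e) (𝒢.tgtHom e c) * (t e)⁻¹ = f (𝒢.src e) (𝒢.srcHom e c))
    (htree : ∀ e ∈ T, t e = 1) : 𝒢.FundamentalGroup T →* H :=
  QuotientGroup.lift (Subgroup.normalClosure (𝒢.relators T))
    (Monoid.Coprod.lift (Monoid.CoprodI.lift f) (FreeGroup.lift t)) (by
      intro x hx
      refine Subgroup.normalClosure_le_normal ?_ hx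
      rintro _ (⟨e, c, rfl⟩ | ⟨e, he, rfl⟩)
      · simp [freeEdge, freeVertex, hrel]
      · simp [freeEdge, htree e he])

section

variable {H : Type*} [Group H] (f : ∀ v, 𝒢.vertexGroup v →* H) (t : 𝒢.E → H)
    (hrel : ∀ e c, t e * f (𝒢.tgt e) (𝒢.tgtHom e c) * (t e)⁻¹ = f (𝒢.src e) (𝒢.srcHom e c))
    (htree : ∀ e ∈ T, t e = 1)

@[simp] theorem liftHom_ofVertex (v : 𝒢.V) (x : 𝒢.vertexGroup v) :
    liftHom f t hrel htree (𝒢.ofVertex T v x) = f v x := by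
  simp [liftHom, ofVertex, freeVertex]

@[simp] theorem liftHom_edgeElt (e : 𝒢.E) :
    liftHom f t hrel htree (𝒢.edgeElt T e) = t e := by
  simp [liftHom, edgeElt, freeEdge]

end

theorem fundamentalGroup_hom_ext {H : Type*} [Group H] {f g : 𝒢.FundamentalGroup T →* H}
    (hv : ∀ v x, f (𝒢.ofVertex T v x) = g (𝒢.ofVertex T v x))
    (he : ∀ e, f (𝒢.edgeElt T e) = g (𝒢.edgeElt T e)) : f = g := by
  apply QuotientGroup.monoidHom_ext
  apply Monoid.Coprod.hom_ext
  · apply Monoid.CoprodI.ext_hom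
    intro v
    ext x
    exact hv v x
  · ext e
    exact he e

/-- The fundamental group is generated by the vertex groups and the stable letters. -/
theorem eq_top_of_generators (S : Subgroup (𝒢.FundamentalGroup T))
    (hv : ∀ v x, 𝒢.ofVertex T v x ∈ S) (he : ∀ e, 𝒢.edgeElt T e ∈ S) : S = ⊤ := by
  let f : 𝒢.FundamentalGroup T →* S :=
    liftHom (fun v => (𝒢.ofVertex T v).codRestrict S (hv v)) (fun e => ⟨𝒢.edgeElt T e, he e⟩)
      (fun e c => Subtype.ext (𝒢.edgeElt_conj T e c))
      (fun e he => Subtype.ext (𝒢.edgeElt_eq_one T he))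
  have h : S.subtype.comp f = MonoidHom.id _ := by
    apply fundamentalGroup_hom_ext
    · intro v x
      simp [f]
    · intro e
      simp [f]
  rw [eq_top_iff]
  intro x _
  have := DFunLike.congr_fun h x
  simp only [MonoidHom.comp_apply, MonoidHom.id_apply] at this
  rw [← this]
  exact (f x).2

end UniversalProperty

/-! ### Reduced words in the path group and Britton's lemma. -/

section Words

variable {𝒢 : GraphOfGroups.{u₁, u₂, u₃, u₄}}

/-- The same edge with the opposite orientation. -/
def bar (a : 𝒢.E × Bool) : 𝒢.E × Bool := (a.1, !a.2)

/-- The initial vertex of an oriented edge. -/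
def init : 𝒢.E × Bool → 𝒢.V
  | (e, true) => 𝒢.src e
  | (e, false) => 𝒢.tgt e

/-- The terminal vertex of an oriented edge. -/
def term : 𝒢.E × Bool → 𝒢.V
  | (e, true) => 𝒢.tgt e
  | (e, false) => 𝒢.src e

@[simp] theorem bar_bar (a : 𝒢.E × Bool) : bar (bar a) = a := by
  simp [bar]

@[simp] theorem init_bar (a : 𝒢.E × Bool) : init (bar a) = term a := by
  rcases a with ⟨e, _ | _⟩ <;> rfl

@[simp] theorem term_bar (a : 𝒢.E × Bool) : term (bar a) = init a := by
  rcases a with ⟨e, _ | _⟩ <;> rfl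

/-- The element of the path group represented by an oriented edge. -/
def letter : 𝒢.E × Bool → 𝒢.FundamentalGroup ∅
  | (e, true) => 𝒢.edgeElt ∅ e
  | (e, false) => (𝒢.edgeElt ∅ e)⁻¹

@[simp] theorem letter_bar (a : 𝒢.E × Bool) : letter (bar a) = (letter a)⁻¹ := by
  rcases a with ⟨e, _ | _⟩ <;> simp [bar, letter]

variable (𝒢) in
/-- A vertex group as a subgroup of the path group. -/
def vertexGp (v : 𝒢.V) : Subgroup (𝒢.FundamentalGroup ∅) := (𝒢.ofVertex ∅ v).range

/-- The edge group of an oriented edge as a subgroup of the vertex group at its terminal vertex,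
inside the path group. -/
def edgeGp : 𝒢.E × Bool → Subgroup (𝒢.FundamentalGroup ∅)
  | (e, true) => ((𝒢.ofVertex ∅ (𝒢.tgt e)).comp (𝒢.tgtHom e)).range
  | (e, false) => ((𝒢.ofVertex ∅ (𝒢.src e)).comp (𝒢.srcHom e)).range

theorem edgeGp_le_vertexGp (a : 𝒢.E × Bool) : edgeGp a ≤ 𝒢.vertexGp (term a) := by
  rcases a with ⟨e, _ | _⟩ <;> (rintro _ ⟨c, rfl⟩; exact ⟨_, rfl⟩)

theorem letter_conj_mem {a : 𝒢.E × Bool} {x : 𝒢.FundamentalGroup ∅} (hx : x ∈ edgeGp a) :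
    letter a * x * (letter a)⁻¹ ∈ edgeGp (bar a) := by
  rcases a with ⟨e, _ | _⟩ <;> obtain ⟨c, rfl⟩ := hx <;> refine ⟨c, ?_⟩
  · simp only [MonoidHom.comp_apply, letter, ← 𝒢.edgeElt_conj ∅ e c]
    group
  · simp only [MonoidHom.comp_apply, letter, ← 𝒢.edgeElt_conj ∅ e c]

theorem letter_inv_conj_mem {a : 𝒢.E × Bool} {x : 𝒢.FundamentalGroup ∅}
    (hx : x ∈ edgeGp (bar a)) : (letter a)⁻¹ * x * letter a ∈ edgeGp a := by
  simpa using letter_conj_mem hx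

variable (𝒢) in
/-- The homomorphism from the free product of the vertex groups to the path group. -/
def ofBase : Monoid.CoprodI 𝒢.vertexGroup →* 𝒢.FundamentalGroup ∅ :=
  (QuotientGroup.mk' (Subgroup.normalClosure (𝒢.relators ∅))).comp Monoid.Coprod.inl

theorem vertexGp_le_range_ofBase (v : 𝒢.V) : 𝒢.vertexGp v ≤ 𝒢.ofBase.range := by
  rintro _ ⟨x, rfl⟩
  exact ⟨Monoid.CoprodI.of x, rfl⟩

/-- The element of the path group represented by a word. -/
def eval (L : List ((𝒢.E × Bool) × 𝒢.FundamentalGroup ∅)) : 𝒢.FundamentalGroup ∅ :=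
  (L.map fun x => letter x.1 * x.2).prod

@[simp] theorem eval_nil : eval ([] : List ((𝒢.E × Bool) × 𝒢.FundamentalGroup ∅)) = 1 := rfl

@[simp] theorem eval_cons (x : (𝒢.E × Bool) × 𝒢.FundamentalGroup ∅)
    (L : List ((𝒢.E × Bool) × 𝒢.FundamentalGroup ∅)) :
    eval (x :: L) = letter x.1 * x.2 * eval L := by
  simp [eval]

/-- A word is reduced if it contains no backtracking. -/
def Reduced (L : List ((𝒢.E × Bool) × 𝒢.FundamentalGroup ∅)) : Prop :=
  L.IsChain fun x y => y.1 = bar x.1 → x.2 ∉ edgeGp x.1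

/-- The path group is the multiple HNN extension with base the free product of the vertex groups, so
the permutations built for such extensions define an action of it. Since the base preserves sheets,
a nonempty reduced word cannot lie in the base. -/
theorem exists_action_of_reduced (L : List ((𝒢.E × Bool) × Monoid.CoprodI 𝒢.vertexGroup))
    (hL : Reduced (L.map (Prod.map id 𝒢.ofBase))) :
    ∃ Φ : 𝒢.FundamentalGroup ∅ →* Equiv.Perm (Monoid.CoprodI 𝒢.vertexGroup ×
        (ℕ × Monoid.CoprodI 𝒢.vertexGroup)),
      (∀ k, Φ (𝒢.ofBase k) = leftTranslation _ _ k) ∧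
      Φ (eval (L.map (Prod.map id 𝒢.ofBase))) (1, (L.length, 1)) = (1, (0, 1)) := by
  let α : ∀ e, 𝒢.edgeGroup e →* Monoid.CoprodI 𝒢.vertexGroup :=
    fun e => Monoid.CoprodI.of.comp (𝒢.srcHom e)
  let β : ∀ e, 𝒢.edgeGroup e →* Monoid.CoprodI 𝒢.vertexGroup :=
    fun e => Monoid.CoprodI.of.comp (𝒢.tgtHom e)
  obtain ⟨τ, hτ, hτL⟩ := exists_perm_of_reduced α β
    (fun e => (Monoid.CoprodI.of_injective _).comp (𝒢.srcHom_injective e))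
    (fun e => (Monoid.CoprodI.of_injective _).comp (𝒢.tgtHom_injective e)) L (by
      refine ((List.isChain_map _).mp hL).imp ?_
      rintro ⟨⟨e, b⟩, k⟩ y hxy hy hk
      refine hxy hy ?_
      rcases b with _ | _ <;> obtain ⟨c, hc⟩ := hk <;>
        exact ⟨c, congrArg 𝒢.ofBase hc⟩)
  let Φ : 𝒢.FundamentalGroup ∅ →* Equiv.Perm (Monoid.CoprodI 𝒢.vertexGroup ×
      (ℕ × Monoid.CoprodI 𝒢.vertexGroup)) :=
    liftHom (fun v => (leftTranslation _ _).comp Monoid.CoprodI.of) τ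
      (fun e c => hτ e c) (fun e he => he.elim)
  have hΦ : ∀ k, Φ (𝒢.ofBase k) = leftTranslation _ _ k := by
    have : Φ.comp 𝒢.ofBase = leftTranslation _ _ := by
      apply Monoid.CoprodI.ext_hom
      intro v
      ext1 x
      show Φ (𝒢.ofVertex ∅ v x) = leftTranslation _ _ (Monoid.CoprodI.of x)
      simp [Φ]
    exact DFunLike.congr_fun this
  refine ⟨Φ, hΦ, ?_⟩
  rw [← hτL, eval, map_list_prod, List.map_map, List.map_map]
  congr 3
  funext x
  rcases x with ⟨⟨e, _ | _⟩, k⟩ <;> simp [letter, hΦ, Φ]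

/-- Left translation is faithful; the action attached to the empty word suffices. -/
theorem ofBase_injective : Function.Injective 𝒢.ofBase := by
  rw [injective_iff_map_eq_one]
  intro k hk
  obtain ⟨Φ, hΦ, -⟩ := exists_action_of_reduced (𝒢 := 𝒢) [] List.isChain_nil
  have h := hΦ k
  rw [hk, map_one] at h
  have := congrArg Prod.fst (DFunLike.congr_fun h (1, (0, 1)))
  simpa using this.symm

theorem ofVertex_empty_injective (v : 𝒢.V) : Function.Injective (𝒢.ofVertex ∅ v) :=
  ofBase_injective.comp (Monoid.CoprodI.of_injective v)

/-- **Britton's lemma** for the path group of a graph of groups. -/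
theorem eval_notMem_range_ofBase {L : List ((𝒢.E × Bool) × 𝒢.FundamentalGroup ∅)}
    (hL : ∀ x ∈ L, x.2 ∈ 𝒢.ofBase.range) (hred : Reduced L) (hne : L ≠ []) :
    eval L ∉ 𝒢.ofBase.range := by
  have hlift : ∃ L' : List ((𝒢.E × Bool) × Monoid.CoprodI 𝒢.vertexGroup),
      L'.map (Prod.map id 𝒢.ofBase) = L := by
    clear hred hne
    induction L with
    | nil => exact ⟨[], rfl⟩
    | cons x L ih =>
      obtain ⟨L', rfl⟩ := ih fun y hy => hL y (List.mem_cons_of_mem _ hy)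
      obtain ⟨k, hk⟩ := hL x List.mem_cons_self
      exact ⟨(x.1, k) :: L', by simp [hk]⟩
  obtain ⟨L', rfl⟩ := hlift
  obtain ⟨Φ, hΦ, hΦL⟩ := exists_action_of_reduced L' hred
  rintro ⟨k, hk⟩
  rw [← hk, hΦ] at hΦL
  have := congrArg (fun p => p.2.1) hΦL
  simp only [leftTranslation_apply] at this
  exact hne (by simp [List.length_eq_zero_iff.mp this])

/-- Two reduced words that differ by a factor in the base group begin with the same oriented edge,
and the factor lies in its edge group. -/
theorem mul_eval_ne_eval {L M : List ((𝒢.E × Bool) × 𝒢.FundamentalGroup ∅)}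
    {g : 𝒢.FundamentalGroup ∅} (hL : ∀ x ∈ L, x.2 ∈ 𝒢.ofBase.range)
    (hM : ∀ x ∈ M, x.2 ∈ 𝒢.ofBase.range) (hg : g ∈ 𝒢.ofBase.range)
    (hLred : Reduced L) (hMred : Reduced M) (hne : M ≠ [])
    (hjunction : ∀ x ∈ L.head?, ∀ y ∈ M.head?, x.1 = y.1 → g ∉ edgeGp (bar x.1)) :
    (eval L)⁻¹ * g * eval M ∉ 𝒢.ofBase.range := by
  induction L generalizing g M with
  | nil =>
    intro h
    refine eval_notMem_range_ofBase hM hMred hne ?_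
    rw [eval_nil, inv_one, one_mul] at h
    exact (Subgroup.mul_mem_cancel_left _ hg).mp h
  | cons x L ih =>
    -- The first letter of the left word is moved, inverted, to the front of the right word;
    -- `hjunction` is what keeps the new word reduced.
    have key : (eval (x :: L))⁻¹ * g * eval M =
        (eval L)⁻¹ * x.2⁻¹ * eval ((bar x.1, g) :: M) := by
      simp [mul_assoc]
    rw [key]
    refine ih (fun y hy => hL y (List.mem_cons_of_mem _ hy)) ?_
      (inv_mem (hL x List.mem_cons_self)) hLred.tail ?_ (List.cons_ne_nil _ _) ?_
    · intro y hy
      rcases List.mem_cons.mp hy with rfl | hy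
      · exact hg
      · exact hM y hy
    · refine List.isChain_cons.mpr ⟨fun y hy h => hjunction x (by simp) y hy ?_, hMred⟩
      rw [h, bar_bar]
    · intro z hz y hy h
      simp only [List.head?_cons, Option.mem_def, Option.some.injEq] at hy
      subst hy
      simp only at h
      rw [h, bar_bar, inv_mem_iff]
      exact (List.isChain_cons.mp hLred).1 z hz h

end Words

end GraphOfGroups

namespace GraphOfGroups

variable {𝒢 : GraphOfGroups.{u₁, u₂, u₃, u₄}}

/-! ### Paths in the graph of groups and their reduced decompositions. -/

section Paths

/-- The elements of the path group that are represented by paths between two vertices. -/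
inductive IsPath : 𝒢.V → 𝒢.V → 𝒢.FundamentalGroup ∅ → Prop
  | vertex {u : 𝒢.V} {x : 𝒢.FundamentalGroup ∅} (hx : x ∈ 𝒢.vertexGp u) : IsPath u u x
  | cons {w : 𝒢.V} {a : 𝒢.E × Bool} {h p : 𝒢.FundamentalGroup ∅} (hh : h ∈ 𝒢.vertexGp (init a))
      (hp : IsPath (term a) w p) : IsPath (init a) w (h * letter a * p)

theorem IsPath.one (u : 𝒢.V) : IsPath u u 1 := .vertex (one_mem _)

theorem isPath_letter (a : 𝒢.E × Bool) : IsPath (init a) (term a) (letter a) := by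
  simpa using IsPath.cons (one_mem _) (IsPath.one (term a))

theorem IsPath.vertex_mul {u w : 𝒢.V} {x p : 𝒢.FundamentalGroup ∅} (hx : x ∈ 𝒢.vertexGp u)
    (hp : IsPath u w p) : IsPath u w (x * p) := by
  cases hp with
  | vertex hy => exact .vertex (mul_mem hx hy)
  | cons hh hp =>
    rw [← mul_assoc, ← mul_assoc]
    exact .cons (mul_mem hx hh) hp

theorem IsPath.mul {u v w : 𝒢.V} {p q : 𝒢.FundamentalGroup ∅} (hp : IsPath u v p)
    (hq : IsPath v w q) : IsPath u w (p * q) := by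
  induction hp with
  | vertex hx => exact hq.vertex_mul hx
  | cons hh _ ih =>
    rw [mul_assoc]
    exact .cons hh (ih hq)

theorem IsPath.inv {u w : 𝒢.V} {p : 𝒢.FundamentalGroup ∅} (hp : IsPath u w p) :
    IsPath w u p⁻¹ := by
  induction hp with
  | vertex hx => exact .vertex (inv_mem hx)
  | @cons w a h p hh _ ih =>
    rw [mul_inv_rev, mul_inv_rev]
    refine ih.mul (.mul ?_ (.vertex (inv_mem hh)))
    have := isPath_letter (bar a)
    rwa [init_bar, term_bar, letter_bar] at this

/-- A homomorphism fixing the vertex groups and mapping letters to paths preserves paths. -/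
theorem IsPath.map {τ : 𝒢.FundamentalGroup ∅ →* 𝒢.FundamentalGroup ∅}
    (hv : ∀ v, ∀ x ∈ 𝒢.vertexGp v, τ x = x) (hτ : ∀ a, IsPath (init a) (term a) (τ (letter a)))
    {u w : 𝒢.V} {p : 𝒢.FundamentalGroup ∅} (hp : IsPath u w p) : IsPath u w (τ p) := by
  induction hp with
  | vertex hx => rw [hv _ _ hx]; exact .vertex hx
  | @cons w a h p hh _ ih =>
    rw [map_mul, map_mul, hv _ _ hh]
    exact ((IsPath.vertex hh).mul (hτ a)).mul ih

/-- `L` is the list of letters of a path from `u` to `w`. -/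
def IsWord : 𝒢.V → List ((𝒢.E × Bool) × 𝒢.FundamentalGroup ∅) → 𝒢.V → Prop
  | u, [], w => u = w
  | u, x :: L, w => init x.1 = u ∧ x.2 ∈ 𝒢.vertexGp (term x.1) ∧ IsWord (term x.1) L w

theorem IsWord.isPath {u w : 𝒢.V} {L : List ((𝒢.E × Bool) × 𝒢.FundamentalGroup ∅)}
    (h : IsWord u L w) : IsPath u w (eval L) := by
  induction L generalizing u with
  | nil => cases h; exact .one _
  | cons x L ih =>
    obtain ⟨rfl, hx, hL⟩ := h
    rw [eval_cons]
    exact ((isPath_letter _).mul (.vertex hx)).mul (ih hL)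

theorem IsWord.mem_vertexGp {u w : 𝒢.V} {L : List ((𝒢.E × Bool) × 𝒢.FundamentalGroup ∅)}
    (h : IsWord u L w) : ∀ x ∈ L, x.2 ∈ 𝒢.vertexGp (term x.1) := by
  induction L generalizing u with
  | nil => simp
  | cons x L ih =>
    obtain ⟨-, hx, hL⟩ := h
    intro y hy
    rcases List.mem_cons.mp hy with rfl | hy
    · exact hx
    · exact ih hL y hy

theorem IsWord.take {u w : 𝒢.V} {L : List ((𝒢.E × Bool) × 𝒢.FundamentalGroup ∅)}
    (h : IsWord u L w) (i : ℕ) (hi : i < L.length) : IsWord u (L.take i) (init L[i].1) := by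
  induction L generalizing u i with
  | nil => simp at hi
  | cons x L ih =>
    obtain ⟨rfl, hx, hL⟩ := h
    cases i with
    | zero => exact rfl
    | succ i => exact ⟨rfl, hx, ih hL i (by simpa using hi)⟩

/-- Prepending a letter to a reduced word either leaves it reduced or creates a single backtracking
at the front, which the edge relation absorbs into the leading vertex element. -/
theorem IsPath.exists_reduced {u w : 𝒢.V} {p : 𝒢.FundamentalGroup ∅} (hp : IsPath u w p) :
    ∃ h ∈ 𝒢.vertexGp u, ∃ L, Reduced L ∧ IsWord u L w ∧ p = h * eval L := by
  induction hp with
  | vertex hx => exact ⟨_, hx, [], List.isChain_nil, rfl, by simp⟩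
  | @cons w a h p hh _ ih =>
    obtain ⟨h', hh', L, hL, hLw, rfl⟩ := ih
    by_cases hc : ∃ x ∈ L.head?, x.1 = bar a ∧ h' ∈ edgeGp a
    · obtain ⟨x, hx, hxa, hha⟩ := hc
      obtain ⟨L, rfl⟩ : ∃ L', L = x :: L' := by
        cases L with
        | nil => simp at hx
        | cons y L => exact ⟨L, by simpa using hx⟩
      obtain ⟨-, hx2, hLw⟩ := hLw
      rw [hxa, term_bar] at hx2 hLw
      refine ⟨h * (letter a * h' * (letter a)⁻¹) * x.2, mul_mem (mul_mem hh ?_) hx2, L, hL.tail,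
        hLw, ?_⟩
      · have := edgeGp_le_vertexGp _ (letter_conj_mem hha)
        rwa [term_bar] at this
      · rw [eval_cons, hxa, letter_bar]
        group
    · refine ⟨h, hh, (a, h') :: L, List.isChain_cons.mpr ⟨?_, hL⟩, ⟨rfl, hh', hLw⟩, ?_⟩
      · intro x hx hxa hha
        exact hc ⟨x, hx, hxa, hha⟩
      · simp [mul_assoc]

theorem IsWord.init_getElem_succ {u w : 𝒢.V} {L : List ((𝒢.E × Bool) × 𝒢.FundamentalGroup ∅)}
    (h : IsWord u L w) (i : ℕ) (hi : i + 1 < L.length) :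
    init L[i + 1].1 = term L[i].1 := by
  induction L generalizing u i with
  | nil => simp at hi
  | cons x L ih =>
    obtain ⟨-, -, hL⟩ := h
    cases i with
    | zero => exact (hL.take 0 (by simpa using hi)).symm
    | succ i => exact ih hL i (by simpa using hi)

/-- A reduced decomposition of an element `y` of the path group, represented by a path starting
from `u`: `prefixElt i` is the product of the first `i` letters. -/
structure ReducedPath (u : 𝒢.V) (y : 𝒢.FundamentalGroup ∅) where
  length : ℕ
  edge : ℕ → 𝒢.E × Bool
  elt : ℕ → 𝒢.FundamentalGroup ∅
  prefixElt : ℕ → 𝒢.FundamentalGroup ∅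
  length_pos : 0 < length
  prefixElt_zero : prefixElt 0 ∈ 𝒢.vertexGp u
  prefixElt_succ : ∀ i < length, prefixElt (i + 1) = prefixElt i * letter (edge i) * elt i
  prefixElt_length : prefixElt length = y
  isPath : ∀ i < length, IsPath u (init (edge i)) (prefixElt i)
  init_edge_succ : ∀ i, i + 1 < length → init (edge (i + 1)) = term (edge i)
  elt_mem : ∀ i < length, elt i ∈ 𝒢.vertexGp (term (edge i))
  reduced : ∀ i, i + 1 < length → edge (i + 1) = bar (edge i) → elt i ∉ edgeGp (edge i)
  exists_tail : ∀ r < length, ∃ M, Reduced ((edge r, elt r) :: M) ∧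
    (∀ x ∈ (edge r, elt r) :: M, x.2 ∈ 𝒢.vertexGp (term x.1)) ∧
    y = prefixElt r * eval ((edge r, elt r) :: M)

theorem IsPath.exists_reducedPath {u : 𝒢.V} {y : 𝒢.FundamentalGroup ∅} {w : 𝒢.V}
    (hy : IsPath u w y) (hyu : y ∉ 𝒢.vertexGp u) :
    ∃ P : ReducedPath u y, init (P.edge 0) = u := by
  obtain ⟨h, hh, L, hL, hLw, rfl⟩ := hy.exists_reduced
  have hpos : 0 < L.length := by
    rw [List.length_pos_iff]
    rintro rfl
    exact hyu (by simpa using hh)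
  -- An arbitrary default: it only pads the sequences beyond the end of the word, where nothing is
  -- required of them.
  let d := L[0]
  have hget : ∀ i (hi : i < L.length), L.getD i d = L[i] := fun i hi =>
    List.getD_eq_getElem _ _ hi
  refine ⟨⟨L.length, fun i => (L.getD i d).1, fun i => (L.getD i d).2,
    fun i => h * eval (L.take i), hpos, by simpa using hh, ?_, by simp, ?_, ?_, ?_, ?_, ?_⟩, ?_⟩
  · intro i hi
    simp only [hget i hi]
    rw [List.take_succ_eq_append_getElem hi, eval, List.map_append, List.prod_append, ← eval]
    simp [mul_assoc]
  · intro i hi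
    simp only [hget i hi]
    exact (hLw.take i hi).isPath.vertex_mul hh
  · intro i hi
    simp only [hget i (by omega), hget (i + 1) hi]
    exact hLw.init_getElem_succ i hi
  · intro i hi
    simp only [hget i hi]
    exact hLw.mem_vertexGp _ (List.getElem_mem hi)
  · intro i hi
    simp only [hget i (by omega), hget (i + 1) hi]
    exact List.isChain_iff_getElem.mp hL i hi
  · intro r hr
    have hd : L.drop r = L[r] :: L.drop (r + 1) := List.drop_eq_getElem_cons hr
    refine ⟨L.drop (r + 1), ?_, ?_, ?_⟩
    · simp only [hget r hr, Prod.mk.eta, ← hd]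
      exact List.IsChain.drop hL r
    · simp only [hget r hr, Prod.mk.eta, ← hd]
      exact fun x hx => hLw.mem_vertexGp x (List.mem_of_mem_drop hx)
    · simp only [hget r hr, Prod.mk.eta, ← hd]
      rw [mul_assoc, eval, eval, eval, ← List.prod_append, ← List.map_append, List.take_append_drop]
  · simp only [hget 0 hpos]
    have := hLw.take 0 hpos
    exact this.symm

end Paths

/-! ### The fundamental group as the group of loops at a vertex. -/

section Section

variable (T : Set 𝒢.E)

/-- The homomorphism from the path group to the fundamental group. -/
def collapse : 𝒢.FundamentalGroup ∅ →* 𝒢.FundamentalGroup T :=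
  liftHom (𝒢.ofVertex T) (𝒢.edgeElt T) (𝒢.edgeElt_conj T) (fun _ h => h.elim)

theorem collapse_ofVertex (v : 𝒢.V) (x : 𝒢.vertexGroup v) :
    collapse T (𝒢.ofVertex ∅ v x) = 𝒢.ofVertex T v x := by
  simp [collapse]

theorem collapse_edgeElt (e : 𝒢.E) : collapse T (𝒢.edgeElt ∅ e) = 𝒢.edgeElt T e := by
  simp [collapse]

theorem collapse_letter {a : 𝒢.E × Bool} (ha : a.1 ∈ T) : collapse T (letter a) = 1 := by
  rcases a with ⟨e, _ | _⟩ <;> simp [letter, collapse_edgeElt, 𝒢.edgeElt_eq_one T ha]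

variable {T}

theorem IsMaximalSubtree.oriented_unique (hT : 𝒢.IsMaximalSubtree T) {a b : 𝒢.E × Bool}
    (ha : a.1 ∈ T) (hb : b.1 ∈ T) (hi : init a = init b) (ht : term a = term b) : a = b := by
  obtain ⟨e, s⟩ := a
  obtain ⟨e', s'⟩ := b
  have hends : ∀ (e : 𝒢.E) (b : Bool), 𝒢.ends e = s(init (e, b), term (e, b)) := by
    rintro e (_ | _)
    · exact Sym2.eq_swap
    · rfl
  have he : e = e' := hT.no_multiple ha hb (by rw [hends e _, hends e' _, hi, ht])
  subst he
  have := hT.no_loop e ha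
  rcases s with _ | _ <;> rcases s' with _ | _ <;> first
    | rfl
    | exact absurd hi this
    | exact absurd hi this.symm

/-- `γ w` is the product of the letters along the unique path of the tree from `v` to `w`. For an
edge of the tree, the path to one endpoint extends the path to the other by that edge. -/
theorem exists_treePaths (hT : 𝒢.IsMaximalSubtree T) (v : 𝒢.V) :
    ∃ γ : 𝒢.V → 𝒢.FundamentalGroup ∅, γ v = 1 ∧ (∀ w, IsPath v w (γ w)) ∧
      (∀ w, collapse T (γ w) = 1) ∧
      ∀ e ∈ T, γ (𝒢.src e) * 𝒢.edgeElt ∅ e = γ (𝒢.tgt e) := by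
  classical
  let Γ := SimpleGraph.fromEdgeSet (𝒢.ends '' T)
  have hΓ : Γ.IsTree := hT.isTree
  have hadj : ∀ u w, Γ.Adj u w → ∃ a : 𝒢.E × Bool, a.1 ∈ T ∧ init a = u ∧ term a = w := by
    intro u w h
    obtain ⟨⟨e, he, hs⟩, -⟩ := (SimpleGraph.fromEdgeSet_adj _).mp h
    rcases Sym2.eq_iff.mp hs with ⟨h1, h2⟩ | ⟨h1, h2⟩
    · exact ⟨(e, true), he, h1, h2⟩
    · exact ⟨(e, false), he, h2, h1⟩
  let f : 𝒢.V → 𝒢.V → 𝒢.FundamentalGroup ∅ := fun u w =>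
    if h : ∃ a : 𝒢.E × Bool, a.1 ∈ T ∧ init a = u ∧ term a = w then letter h.choose else 1
  have hf : ∀ a : 𝒢.E × Bool, a.1 ∈ T → f (init a) (term a) = letter a := by
    intro a ha
    have h : ∃ b : 𝒢.E × Bool, b.1 ∈ T ∧ init b = init a ∧ term b = term a := ⟨a, ha, rfl, rfl⟩
    simp only [f, dif_pos h]
    rw [hT.oriented_unique h.choose_spec.1 ha h.choose_spec.2.1 h.choose_spec.2.2]
  let W : ∀ {u w : 𝒢.V}, Γ.Walk u w → 𝒢.FundamentalGroup ∅ := fun p =>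
    (p.darts.map fun d => f d.fst d.snd).prod
  have hWcons : ∀ {u w z : 𝒢.V} (h : Γ.Adj u w) (p : Γ.Walk w z),
      W (SimpleGraph.Walk.cons h p) = f u w * W p := by
    intro u w z h p
    simp [W]
  have hWconcat : ∀ {u w z : 𝒢.V} (p : Γ.Walk u w) (h : Γ.Adj w z),
      W (p.concat h) = W p * f w z := by
    intro u w z p h
    simp [W]
  have hWpath : ∀ {u w : 𝒢.V} (p : Γ.Walk u w), IsPath u w (W p) ∧ collapse T (W p) = 1 := by
    intro u w p
    induction p with
    | nil => exact ⟨.one _, map_one _⟩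
    | cons h p ih =>
      obtain ⟨a, ha, rfl, rfl⟩ := hadj _ _ h
      rw [hWcons, hf a ha, map_mul, collapse_letter T ha, ih.2]
      exact ⟨(isPath_letter a).mul ih.1, one_mul _⟩
  choose P hP _ using fun w => hΓ.existsUnique_path v w
  refine ⟨fun w => W (P w), ?_, fun w => (hWpath _).1, fun w => (hWpath _).2, ?_⟩
  · have : P v = SimpleGraph.Walk.nil :=
      (hΓ.existsUnique_path v v).unique (hP v) SimpleGraph.Walk.IsPath.nil
    simp only [this]
    rfl
  · intro e he
    have ha : Γ.Adj (𝒢.src e) (𝒢.tgt e) :=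
      (SimpleGraph.fromEdgeSet_adj _).mpr ⟨⟨e, he, rfl⟩, hT.no_loop e he⟩
    have h1 : f (𝒢.src e) (𝒢.tgt e) = 𝒢.edgeElt ∅ e := hf (e, true) he
    have h2 : f (𝒢.tgt e) (𝒢.src e) = (𝒢.edgeElt ∅ e)⁻¹ := hf (e, false) he
    by_cases hs : 𝒢.src e ∈ (P (𝒢.tgt e)).support
    · simp only
      rw [hΓ.isAcyclic.path_concat (hP _) (hP _) ha hs, hWconcat, h1]
    · have ht := hΓ.isAcyclic.mem_support_of_ne_mem_support_of_adj_of_isPath (hP _) (hP _)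
        ha hs
      simp only
      rw [hΓ.isAcyclic.path_concat (hP _) (hP _) ha.symm ht, hWconcat, h2]
      simp

/-- A section of `collapse` with values in the paths from `v` to `v`. -/
theorem exists_section (hT : 𝒢.IsMaximalSubtree T) (v : 𝒢.V) :
    (∀ w, ∃ γ, IsPath v w γ) ∧ ∃ ψ : 𝒢.FundamentalGroup T →* 𝒢.FundamentalGroup ∅,
      (∀ x, collapse T (ψ x) = x) ∧ (∀ x, IsPath v v (ψ x)) ∧
      ∀ p, IsPath v v p → ψ (collapse T p) = p := by
  obtain ⟨γ, hγv, hγ, hγ1, hγT⟩ := exists_treePaths hT v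
  refine ⟨fun w => ⟨γ w, hγ w⟩, ?_⟩
  let ψ : 𝒢.FundamentalGroup T →* 𝒢.FundamentalGroup ∅ :=
    liftHom (fun w => (MulAut.conj (γ w)).toMonoidHom.comp (𝒢.ofVertex ∅ w))
      (fun e => γ (𝒢.src e) * 𝒢.edgeElt ∅ e * (γ (𝒢.tgt e))⁻¹)
      (by
        intro e c
        simp only [MonoidHom.comp_apply, MulEquiv.toMonoidHom_eq_coe, MonoidHom.coe_coe,
          MulAut.conj_apply, ← 𝒢.edgeElt_conj ∅ e c]
        group)
      (fun e he => by rw [hγT e he, mul_inv_cancel])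
  have hψv : ∀ w x, ψ (𝒢.ofVertex T w x) = γ w * 𝒢.ofVertex ∅ w x * (γ w)⁻¹ := by
    intro w x
    simp [ψ]
  have hψe : ∀ e, ψ (𝒢.edgeElt T e) = γ (𝒢.src e) * 𝒢.edgeElt ∅ e * (γ (𝒢.tgt e))⁻¹ := by
    intro e
    simp [ψ]
  have hψl : ∀ a, ψ (collapse T (letter a)) = γ (init a) * letter a * (γ (term a))⁻¹ := by
    rintro ⟨e, _ | _⟩
    · simp only [letter, map_inv, collapse_edgeElt, hψe, init, term]
      group
    · simp only [letter, collapse_edgeElt, hψe, init, term]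
  refine ⟨ψ, ?_, ?_, ?_⟩
  · have : (collapse T).comp ψ = MonoidHom.id _ := by
      apply fundamentalGroup_hom_ext
      · intro w x
        simp [hψv, hγ1, collapse_ofVertex]
      · intro e
        simp [hψe, hγ1, collapse_edgeElt]
    exact DFunLike.congr_fun this
  · let S : Subgroup (𝒢.FundamentalGroup T) :=
      { carrier := {x | IsPath v v (ψ x)}
        mul_mem' := fun {x y} hx hy => by
          simp only [Set.mem_ofPred_eq, map_mul] at *
          exact hx.mul hy
        one_mem' := by
          simp only [Set.mem_ofPred_eq, map_one]
          exact .one _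
        inv_mem' := fun {x} hx => by
          simp only [Set.mem_ofPred_eq, map_inv] at *
          exact hx.inv }
    have hS : S = ⊤ := by
      apply eq_top_of_generators
      · intro w x
        show IsPath v v (ψ _)
        rw [hψv]
        exact ((hγ w).mul (.vertex ⟨x, rfl⟩)).mul (hγ w).inv
      · intro e
        show IsPath v v (ψ _)
        rw [hψe]
        exact ((hγ _).mul (isPath_letter (e, true))).mul (hγ _).inv
    intro x
    have : x ∈ S := hS ▸ Subgroup.mem_top x
    exact this
  · have key : ∀ u w p, IsPath u w p → ψ (collapse T p) = γ u * p * (γ w)⁻¹ := by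
      intro u w p hp
      induction hp with
      | vertex hx =>
        obtain ⟨x, rfl⟩ := hx
        rw [collapse_ofVertex, hψv]
      | @cons w a h p hh _ ih =>
        obtain ⟨x, rfl⟩ := hh
        rw [map_mul, map_mul, map_mul, map_mul, ih, hψl, collapse_ofVertex, hψv]
        group
    intro p hp
    rw [key v v p hp, hγv]
    simp

end Section

/-! ### Dehn twists of the path group. -/

section Twist

/-- `τ` is the Dehn twist of the path group multiplying the letter `a` by the element `c` of its
edge group. -/
structure IsTwist (a : 𝒢.E × Bool) (c : 𝒢.FundamentalGroup ∅)
    (τ : 𝒢.FundamentalGroup ∅ →* 𝒢.FundamentalGroup ∅) : Prop where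
  map_vertex : ∀ v, ∀ x ∈ 𝒢.vertexGp v, τ x = x
  map_letter : τ (letter a) = letter a * c
  map_letter_of_ne : ∀ b, b ≠ a → b ≠ bar a → τ (letter b) = letter b

theorem IsTwist.bar {a : 𝒢.E × Bool} {c : 𝒢.FundamentalGroup ∅}
    {τ : 𝒢.FundamentalGroup ∅ →* 𝒢.FundamentalGroup ∅} (h : IsTwist a c τ) :
    IsTwist (bar a) (letter a * c⁻¹ * (letter a)⁻¹) τ where
  map_vertex := h.map_vertex
  map_letter := by
    rw [letter_bar, map_inv, h.map_letter]
    group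
  map_letter_of_ne b hb hb' := h.map_letter_of_ne b (by simpa using hb') hb

theorem IsTwist.exists_edgeGp {a : 𝒢.E × Bool} {c : 𝒢.FundamentalGroup ∅}
    {τ : 𝒢.FundamentalGroup ∅ →* 𝒢.FundamentalGroup ∅} (h : IsTwist a c τ) (hc : c ∈ edgeGp a)
    (b : 𝒢.E × Bool) : ∃ d ∈ edgeGp b, τ (letter b) = letter b * d := by
  by_cases hb : b = a
  · subst hb
    exact ⟨c, hc, h.map_letter⟩
  by_cases hb' : b = GraphOfGroups.bar a
  · subst hb'
    exact ⟨_, letter_conj_mem (inv_mem hc), h.bar.map_letter⟩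
  · exact ⟨1, one_mem _, by rw [h.map_letter_of_ne b hb hb', mul_one]⟩

/-- Replacing the stable letter t by tc preserves the edge relations because c centralizes the
abelian edge group. A negatively oriented edge is reduced to a positive one by reversal. -/
theorem exists_isTwist (hab : ∀ e, IsMulCommutative (𝒢.edgeGroup e)) {a : 𝒢.E × Bool}
    {c : 𝒢.FundamentalGroup ∅} (hc : c ∈ edgeGp a) : ∃ τ, IsTwist a c τ := by
  classical
  have main : ∀ e, ∀ c ∈ edgeGp (e, true), ∃ τ, IsTwist (𝒢 := 𝒢) (e, true) c τ := by
    rintro e _ ⟨c, rfl⟩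
    let t : 𝒢.E → 𝒢.FundamentalGroup ∅ := Function.update (𝒢.edgeElt ∅) e
      (𝒢.edgeElt ∅ e * 𝒢.ofVertex ∅ (𝒢.tgt e) (𝒢.tgtHom e c))
    have ht : t e = 𝒢.edgeElt ∅ e * 𝒢.ofVertex ∅ (𝒢.tgt e) (𝒢.tgtHom e c) :=
      Function.update_self _ _ _
    have ht' : ∀ e' ≠ e, t e' = 𝒢.edgeElt ∅ e' := fun e' h => Function.update_of_ne h _ _
    refine ⟨liftHom (𝒢.ofVertex ∅) t ?_ (fun _ h => h.elim), ?_, ?_, ?_⟩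
    · intro e' d
      by_cases h : e' = e
      · subst h
        have hcd : c * d * c⁻¹ = d := by
          rw [(hab e').is_comm.comm c d, mul_inv_cancel_right]
        rw [ht, ← 𝒢.edgeElt_conj ∅ e' d]
        conv_rhs => rw [← hcd]
        simp only [map_mul, map_inv]
        group
      · rw [ht' e' h, 𝒢.edgeElt_conj]
    · rintro v _ ⟨x, rfl⟩
      simp
    · simp [letter, ht]
    · rintro ⟨e', _ | _⟩ h1 h2
      · have h : e' ≠ e := by
          rintro rfl
          exact h2 rfl
        simp [letter, ht' e' h]
      · have h : e' ≠ e := by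
          rintro rfl
          exact h1 rfl
        simp [letter, ht' e' h]
  rcases a with ⟨e, _ | _⟩
  · obtain ⟨τ, hτ⟩ := main e _ (letter_conj_mem (inv_mem hc))
    refine ⟨τ, ?_⟩
    have := hτ.bar
    have hl : letter (e, true) = (letter (e, false) : 𝒢.FundamentalGroup ∅)⁻¹ := by simp [letter]
    rw [hl] at this
    have hc' : (letter (e, false))⁻¹ * (letter (e, false) * c⁻¹ * (letter (e, false))⁻¹)⁻¹ *
        (letter (e, false))⁻¹⁻¹ = c := by
      group
    rwa [hc'] at this
  · exact main e c hc

theorem IsTwist.comp_inv {a : 𝒢.E × Bool} {c : 𝒢.FundamentalGroup ∅} (hc : c ∈ edgeGp a)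
    {τ σ : 𝒢.FundamentalGroup ∅ →* 𝒢.FundamentalGroup ∅} (hτ : IsTwist a c τ)
    (hσ : IsTwist a c⁻¹ σ) (x : 𝒢.FundamentalGroup ∅) : σ (τ x) = x := by
  have hl : σ (τ (letter a)) = letter a := by
    rw [hτ.map_letter, map_mul, hσ.map_letter, hσ.map_vertex _ _ (edgeGp_le_vertexGp a hc)]
    group
  have hletter : ∀ b, σ (τ (letter b)) = letter b := by
    intro b
    by_cases hb : b = a
    · rw [hb, hl]
    by_cases hb' : b = GraphOfGroups.bar a
    · rw [hb', letter_bar, map_inv, map_inv, hl]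
    · rw [hτ.map_letter_of_ne b hb hb', hσ.map_letter_of_ne b hb hb']
  have : σ.comp τ = MonoidHom.id _ := by
    apply fundamentalGroup_hom_ext
    · intro v x
      have hx : 𝒢.ofVertex ∅ v x ∈ 𝒢.vertexGp v := ⟨x, rfl⟩
      rw [MonoidHom.comp_apply, hτ.map_vertex v _ hx, hσ.map_vertex v _ hx, MonoidHom.id_apply]
    · intro e
      exact hletter (e, true)
  exact DFunLike.congr_fun this x

theorem IsTwist.isPath_map {a : 𝒢.E × Bool} {c : 𝒢.FundamentalGroup ∅}
    {τ : 𝒢.FundamentalGroup ∅ →* 𝒢.FundamentalGroup ∅} (h : IsTwist a c τ) (hc : c ∈ edgeGp a)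
    {u w : 𝒢.V} {p : 𝒢.FundamentalGroup ∅} (hp : IsPath u w p) : IsPath u w (τ p) := by
  refine hp.map h.map_vertex fun b => ?_
  obtain ⟨d, hd, hb⟩ := h.exists_edgeGp hc b
  rw [hb]
  exact (isPath_letter b).mul (.vertex (edgeGp_le_vertexGp b hd))

/-- A twist maps reduced words to reduced words with the same edges. -/
theorem IsTwist.exists_map_eval {a : 𝒢.E × Bool} {c : 𝒢.FundamentalGroup ∅}
    {τ : 𝒢.FundamentalGroup ∅ →* 𝒢.FundamentalGroup ∅} (h : IsTwist a c τ) (hc : c ∈ edgeGp a)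
    {L : List ((𝒢.E × Bool) × 𝒢.FundamentalGroup ∅)} (hL : Reduced L)
    (hLv : ∀ x ∈ L, x.2 ∈ 𝒢.vertexGp (term x.1)) :
    ∃ L', τ (eval L) = eval L' ∧ Reduced L' ∧ L'.map Prod.fst = L.map Prod.fst ∧
      ∀ x ∈ L', x.2 ∈ 𝒢.vertexGp (term x.1) := by
  choose d hd hτ using h.exists_edgeGp hc
  refine ⟨L.map fun x => (x.1, d x.1 * x.2), ?_, ?_, ?_, ?_⟩
  · clear hL
    induction L with
    | nil => simp
    | cons x L ih =>
      rw [eval_cons, map_mul, map_mul, ih fun y hy => hLv y (List.mem_cons_of_mem _ hy),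
        h.map_vertex _ _ (hLv x List.mem_cons_self), hτ]
      simp [mul_assoc]
  -- Each vertex element changes only by a left factor in the edge group of its own letter, so its
  -- membership in that edge group does not change.
  · refine (List.isChain_map _).mpr (List.IsChain.imp ?_ hL)
    intro x y hxy hy hx
    exact hxy hy ((Subgroup.mul_mem_cancel_left _ (hd x.1)).mp hx)
  · rw [List.map_map]
    rfl
  · intro y hy
    obtain ⟨x, hx, rfl⟩ := List.mem_map.mp hy
    exact mul_mem (edgeGp_le_vertexGp _ (hd x.1)) (hLv x hx)

end Twist

end GraphOfGroups

/-! ### Prefixes and inverse letters of a reduced word in a free group. -/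

section FreeGroup

variable {E : Type*} {a : ℕ → E × Bool} {f : ℕ → FreeGroup E} {r : ℕ}

theorem FreeGroup.inv_mul_eq_mk_range' (hf : ∀ i < r, f (i + 1) = f i * FreeGroup.mk [a i])
    (i k : ℕ) (h : i + k ≤ r) :
    (f i)⁻¹ * f (i + k) = FreeGroup.mk ((List.range' i k).map a) := by
  induction k with
  | zero => simp [FreeGroup.one_eq_mk]
  | succ k ih =>
    rw [← add_assoc, hf (i + k) (by omega), ← mul_assoc, ih (by omega), FreeGroup.mul_mk,
      List.range'_1_concat, List.map_append]
    rfl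

theorem FreeGroup.norm_inv_mul_le [DecidableEq E]
    (hf : ∀ i < r, f (i + 1) = f i * FreeGroup.mk [a i])
    {i j : ℕ} (hij : i ≤ j) (hj : j ≤ r) : ((f i)⁻¹ * f j).norm ≤ j - i := by
  obtain ⟨k, rfl⟩ := Nat.exists_eq_add_of_le hij
  rw [FreeGroup.inv_mul_eq_mk_range' hf i k hj]
  refine FreeGroup.norm_mk_le.trans ?_
  simp

theorem FreeGroup.norm_inv_mul_eq [DecidableEq E]
    (hf : ∀ i < r, f (i + 1) = f i * FreeGroup.mk [a i])
    (hred : ∀ i, i + 1 < r → a (i + 1) ≠ ((a i).1, !(a i).2))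
    {i j : ℕ} (hij : i ≤ j) (hj : j ≤ r) : ((f i)⁻¹ * f j).norm = j - i := by
  obtain ⟨k, rfl⟩ := Nat.exists_eq_add_of_le hij
  have hL : FreeGroup.IsReduced ((List.range' i k).map a) := by
    refine List.isChain_iff_getElem.mpr fun m hm => ?_
    simp only [List.length_map, List.length_range'] at hm
    simp only [List.getElem_map, List.getElem_range', one_mul]
    intro h1
    by_contra h2
    refine hred (i + m) (by omega) (Prod.ext h1.symm ?_)
    rw [add_assoc]
    exact (Bool.not_eq_not.mp (by simpa using Ne.symm h2))
  rw [FreeGroup.inv_mul_eq_mk_range' hf i k hj, FreeGroup.norm, FreeGroup.toWord_mk, hL.reduce_eq]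
  simp

/-- If the loops closing up at pairs of inverse letters of a reduced word commute, then some letter
of the word is such that its inverse does not occur. -/
theorem FreeGroup.exists_forall_ne_inv (hr : 0 < r)
    (hf : ∀ i < r, f (i + 1) = f i * FreeGroup.mk [a i])
    (hred : ∀ i, i + 1 < r → a (i + 1) ≠ ((a i).1, !(a i).2))
    (hcomm : ∀ i j k l, i < j → j < r → k < l → l < r → a j = ((a i).1, !(a i).2) →
      a l = ((a k).1, !(a k).2) → Commute (f (j + 1) * (f i)⁻¹) (f (l + 1) * (f k)⁻¹)) :
    ∃ l < r, ∀ k < r, a k ≠ ((a l).1, !(a l).2) := by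
  classical
  have hsymm : ∀ {x y : E × Bool}, x = (y.1, !y.2) → y = (x.1, !x.2) := by
    rintro x y rfl
    simp
  have hne : ∀ x : E × Bool, x ≠ (x.1, !x.2) := by
    rintro ⟨x, _ | _⟩ <;> simp
  have hinv : ∀ {x y : E × Bool}, x = (y.1, !y.2) →
      FreeGroup.mk [x] = (FreeGroup.mk [y])⁻¹ := by
    rintro x y rfl
    simp [FreeGroup.inv_mk, FreeGroup.invRev]
  by_cases hpair : ∃ d i, i + d < r ∧ 0 < d ∧ a (i + d) = ((a i).1, !(a i).2)
  -- Take an inverse pair (i, j) at minimal distance; the letter at i + 1 is the one sought.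
  -- Minimality excludes its inverse strictly between i + 1 and j.
  · obtain ⟨i, hid, hd, hai⟩ := Nat.find_spec hpair
    have hmin : ∀ i' j', i' < j' → j' < r → j' - i' < Nat.find hpair →
        a j' ≠ ((a i').1, !(a i').2) := by
      intro i' j' h1 h2 h3 h4
      refine Nat.find_min hpair h3 ⟨i', by omega, by omega, ?_⟩
      rwa [show i' + (j' - i') = j' by omega]
    obtain ⟨j, hj⟩ : ∃ j, j = i + Nat.find hpair := ⟨_, rfl⟩
    rw [← hj] at hid hai
    have hij : i + 1 < j := by
      rcases Nat.lt_or_ge (i + 1) j with h | h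
      · exact h
      · have : j = i + 1 := by omega
        subst this
        exact absurd hai (hred i hid)
    have hσ : f (j + 1) * (f i)⁻¹ = f j * (f (i + 1))⁻¹ := by
      rw [hf j hid, hf i (by omega), hinv hai]
      group
    refine ⟨i + 1, by omega, fun k hk hak => ?_⟩
    rcases lt_trichotomy k i with hki | rfl | hki
    · have hg : f (i + 1 + 1) * (f k)⁻¹ = f (i + 1) * (f (k + 1))⁻¹ := by
        rw [hf (i + 1) (by omega), hf k hk, hinv (hsymm hak)]
        group
      have hc := hcomm i j k (i + 1) (by omega) hid (by omega) (by omega) hai (hsymm hak)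
      -- Commutation rewrites a reduced subword of length j - k as a product of two elements of
      -- lengths at most j - i - 1 and i - k - 1, which is too short by 2. The case k > j below is
      -- analogous.
      have hEq : (f (k + 1))⁻¹ * f (j + 1) =
          ((f (i + 1))⁻¹ * f j) * ((f (k + 1))⁻¹ * f i) := by
        have h1 : f (j + 1) * (f i)⁻¹ * (f (i + 1) * (f (k + 1))⁻¹) =
            f (i + 1) * (f (k + 1))⁻¹ * (f (j + 1) * (f i)⁻¹) := by
          rw [← hg]
          exact hc.eq
        rw [hσ] at h1
        calc (f (k + 1))⁻¹ * f (j + 1)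
            = (f (i + 1))⁻¹ * (f (i + 1) * (f (k + 1))⁻¹ * (f (j + 1) * (f i)⁻¹)) * f i := by group
          _ = (f (i + 1))⁻¹ * (f j * (f (i + 1))⁻¹ * (f (i + 1) * (f (k + 1))⁻¹)) * f i := by
            rw [hσ, h1]
          _ = _ := by group
      have h1 := FreeGroup.norm_inv_mul_eq hf hred (show k + 1 ≤ j + 1 by omega)
        (show j + 1 ≤ r by omega)
      rw [hEq] at h1
      have h2 := FreeGroup.norm_mul_le ((f (i + 1))⁻¹ * f j) ((f (k + 1))⁻¹ * f i)
      have h3 := FreeGroup.norm_inv_mul_le hf (show i + 1 ≤ j by omega) (show j ≤ r by omega)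
      have h4 := FreeGroup.norm_inv_mul_le hf (show k + 1 ≤ i by omega) (show i ≤ r by omega)
      omega
    · exact hred k (by omega) (hsymm hak)
    · have hk1 : k ≠ i + 1 := by
        rintro rfl
        exact hne _ hak
      rcases Nat.lt_or_ge j k with hjk | hjk
      · have hg : f (k + 1) * (f (i + 1))⁻¹ = f k * (f (i + 1 + 1))⁻¹ := by
          rw [hf (i + 1) (by omega), hf k hk, hinv hak]
          group
        have hc := hcomm i j (i + 1) k (by omega) hid (by omega) hk hai hak
        have hEq : (f (i + 1))⁻¹ * f (k + 1) =
            ((f j)⁻¹ * f k) * ((f (i + 1 + 1))⁻¹ * f j) := by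
          have h1 := hc.eq
          rw [hσ] at h1
          calc (f (i + 1))⁻¹ * f (k + 1)
              = (f j)⁻¹ * (f j * (f (i + 1))⁻¹ * (f (k + 1) * (f (i + 1))⁻¹)) * f (i + 1) := by
                group
            _ = (f j)⁻¹ * (f (k + 1) * (f (i + 1))⁻¹) * f j := by
              rw [h1]
              group
            _ = _ := by
              rw [hg]
              group
        have h1 := FreeGroup.norm_inv_mul_eq hf hred (show i + 1 ≤ k + 1 by omega)
          (show k + 1 ≤ r by omega)
        rw [hEq] at h1
        have h2 := FreeGroup.norm_mul_le ((f j)⁻¹ * f k) ((f (i + 1 + 1))⁻¹ * f j)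
        have h3 := FreeGroup.norm_inv_mul_le hf (show j ≤ k by omega) (show k ≤ r by omega)
        have h4 := FreeGroup.norm_inv_mul_le hf (show i + 1 + 1 ≤ j by omega)
          (show j ≤ r by omega)
        omega
      · exact hmin (i + 1) k (by omega) hk (by omega) hak
  · refine ⟨0, hr, fun k hk hak => hpair ⟨k, 0, by omega, ?_, by simpa using hak⟩⟩
    rcases Nat.eq_zero_or_pos k with rfl | h
    · exact absurd hak (hne _)
    · exact h

end FreeGroup

theorem IsMaximalAbelian.mem_of_commute {G : Type*} [Group G] {H : Subgroup G}
    (hH : IsMaximalAbelian H) {x : G} (hx : ∀ y ∈ H, Commute x y) : x ∈ H := by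
  have hcomm : ∀ y ∈ H, ∀ z ∈ H, y * z = z * y := fun y hy z hz =>
    congrArg Subtype.val (hH.prop.is_comm.comm (⟨y, hy⟩ : H) ⟨z, hz⟩)
  have hK : IsMulCommutative (Subgroup.closure (insert x (H : Set G))) := by
    apply Subgroup.isMulCommutative_closure
    rintro y (rfl | hy) z (rfl | hz)
    · rfl
    · exact hx z hz
    · exact (hx y hy).symm
    · exact hcomm y hy z hz
  have hle : H ≤ Subgroup.closure (insert x (H : Set G)) := fun y hy =>
    Subgroup.subset_closure (Set.mem_insert_of_mem _ hy)
  exact hH.le_of_ge hK hle (Subgroup.subset_closure (Set.mem_insert _ _))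

namespace GraphOfGroups

variable {𝒢 : GraphOfGroups.{u₁, u₂, u₃, u₄}}

/-! ### Infinitely many values of Dehn twists at a loop. -/

section Core

/-- The algebraic consequences of the CSA property and of torsion-freeness for the group of paths
from `v` to `v`, in a connected graph of groups. -/
structure PathCSA (v : 𝒢.V) : Prop where
  commute_of_conj : ∀ D g, IsPath v v D → IsPath v v g → D ≠ 1 → Commute D (g * D * g⁻¹) →
    Commute g D
  commute_trans : ∀ D x y, IsPath v v D → IsPath v v x → IsPath v v y → D ≠ 1 → Commute D x →
    Commute D y → Commute x y
  zpow_ne_one : ∀ D, IsPath v v D → D ≠ 1 → ∀ z : ℤ, z ≠ 0 → D ^ z ≠ 1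
  connected : ∀ w, ∃ γ, IsPath v w γ

theorem commute_of_mem_edgeGp (hab : ∀ e, IsMulCommutative (𝒢.edgeGroup e)) {a : 𝒢.E × Bool}
    {x y : 𝒢.FundamentalGroup ∅} (hx : x ∈ edgeGp a) (hy : y ∈ edgeGp a) : Commute x y := by
  rcases a with ⟨e, _ | _⟩
  · obtain ⟨c, rfl⟩ := hx
    obtain ⟨d, rfl⟩ := hy
    exact Commute.map ((hab e).is_comm.comm c d) _
  · obtain ⟨c, rfl⟩ := hx
    obtain ⟨d, rfl⟩ := hy
    exact Commute.map ((hab e).is_comm.comm c d) _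

theorem mem_edgeGp_of_commute
    (hmax : ∀ e, IsMaximalAbelian (𝒢.srcHom e).range ∧ IsMaximalAbelian (𝒢.tgtHom e).range)
    {a : 𝒢.E × Bool} {x : 𝒢.FundamentalGroup ∅} (hx : x ∈ 𝒢.vertexGp (term a))
    (hxa : ∀ y ∈ edgeGp a, Commute x y) : x ∈ edgeGp a := by
  rcases a with ⟨e, _ | _⟩
  · obtain ⟨x, rfl⟩ : ∃ z, 𝒢.ofVertex ∅ (𝒢.src e) z = x := hx
    obtain ⟨c, hc⟩ := (hmax e).1.mem_of_commute (x := x) (by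
      rintro _ ⟨c, rfl⟩
      exact ofVertex_empty_injective _ (by simpa using (hxa _ ⟨c, rfl⟩).eq))
    exact ⟨c, congrArg (𝒢.ofVertex ∅ (𝒢.src e)) hc⟩
  · obtain ⟨x, rfl⟩ : ∃ z, 𝒢.ofVertex ∅ (𝒢.tgt e) z = x := hx
    obtain ⟨c, hc⟩ := (hmax e).2.mem_of_commute (x := x) (by
      rintro _ ⟨c, rfl⟩
      exact ofVertex_empty_injective _ (by simpa using (hxa _ ⟨c, rfl⟩).eq))
    exact ⟨c, congrArg (𝒢.ofVertex ∅ (𝒢.tgt e)) hc⟩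

variable {v : 𝒢.V}

/-- Edge groups are malnormal in vertex groups. -/
theorem PathCSA.mem_edgeGp (H : PathCSA v) (hab : ∀ e, IsMulCommutative (𝒢.edgeGroup e))
    (hmax : ∀ e, IsMaximalAbelian (𝒢.srcHom e).range ∧ IsMaximalAbelian (𝒢.tgtHom e).range)
    {a : 𝒢.E × Bool} {x s : 𝒢.FundamentalGroup ∅} (hx : x ∈ 𝒢.vertexGp (term a))
    (hs : s ∈ edgeGp a) (hs1 : s ≠ 1) (hxs : x * s * x⁻¹ ∈ edgeGp a) : x ∈ edgeGp a := by
  -- After transport to loops at `v`, the CSA property makes x commute with s, commutative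
  -- transitivity makes it commute with the whole edge group, and maximality concludes.
  obtain ⟨γ, hγ⟩ := H.connected (term a)
  have hconj : ∀ z ∈ 𝒢.vertexGp (term a), IsPath v v (γ * z * γ⁻¹) := fun z hz =>
    (hγ.mul (.vertex hz)).mul hγ.inv
  have hle := edgeGp_le_vertexGp a
  have hs1' : γ * s * γ⁻¹ ≠ 1 := by
    rwa [Ne, conj_eq_one_iff]
  have h1 : Commute (γ * x * γ⁻¹) (γ * s * γ⁻¹) := by
    refine H.commute_of_conj _ _ (hconj s (hle hs)) (hconj x hx) hs1' ?_
    have : γ * x * γ⁻¹ * (γ * s * γ⁻¹) * (γ * x * γ⁻¹)⁻¹ = γ * (x * s * x⁻¹) * γ⁻¹ := by group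
    rw [this, Commute.conj_iff]
    exact commute_of_mem_edgeGp hab hs hxs
  refine mem_edgeGp_of_commute hmax hx fun y hy => ?_
  rw [← Commute.conj_iff γ]
  exact H.commute_trans _ _ _ (hconj s (hle hs)) (hconj x hx) (hconj y (hle hy)) hs1' h1.symm
    ((Commute.conj_iff γ).mpr (commute_of_mem_edgeGp hab hs hy))

/-- In the Bass-Serre tree, q p⁻¹ carries one edge fixed by D to another edge fixed by D. Thus D and
its conjugate by (q p⁻¹)⁻¹ both lie in one abelian edge stabilizer, and the CSA property applies. -/
theorem PathCSA.commute_mul_inv (H : PathCSA v) (hab : ∀ e, IsMulCommutative (𝒢.edgeGroup e))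
    {D p q : 𝒢.FundamentalGroup ∅} {w : 𝒢.V} {b : 𝒢.E × Bool} (hD : IsPath v v D) (hD1 : D ≠ 1)
    (hp : IsPath v w p) (hq : IsPath v w q) (hpD : p⁻¹ * D * p ∈ edgeGp b)
    (hqD : q⁻¹ * D * q ∈ edgeGp b) : Commute (q * p⁻¹) D := by
  rw [← Commute.inv_left_iff]
  refine H.commute_of_conj _ _ hD (hq.mul hp.inv).inv hD1 ?_
  rw [← Commute.conj_iff p⁻¹]
  have : p⁻¹ * ((q * p⁻¹)⁻¹ * D * (q * p⁻¹)⁻¹⁻¹) * p⁻¹⁻¹ = q⁻¹ * D * q := by group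
  rw [this, inv_inv]
  exact commute_of_mem_edgeGp hab hpD hqD

variable (𝒢) in
/-- The homomorphism from the path group to the free group on the edges. -/
def toFreeGroup : 𝒢.FundamentalGroup ∅ →* FreeGroup 𝒢.E :=
  liftHom (fun _ => 1) FreeGroup.of (fun e c => by simp) (fun _ h => h.elim)

theorem toFreeGroup_vertex {w : 𝒢.V} {x : 𝒢.FundamentalGroup ∅} (hx : x ∈ 𝒢.vertexGp w) :
    𝒢.toFreeGroup x = 1 := by
  obtain ⟨x, rfl⟩ := hx
  simp [toFreeGroup]

theorem toFreeGroup_letter (a : 𝒢.E × Bool) :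
    𝒢.toFreeGroup (letter a) = FreeGroup.mk [a] := by
  rcases a with ⟨e, _ | _⟩
  · simp [letter, toFreeGroup, FreeGroup.of, FreeGroup.inv_mk, FreeGroup.invRev]
  · simp [letter, toFreeGroup, FreeGroup.of]

/-- Dehn twists along a suitable edge of the reduced form of `y` have pairwise distinct values
at `y`. -/
theorem PathCSA.exists_twist_injective (H : PathCSA v)
    (hab : ∀ e, IsMulCommutative (𝒢.edgeGroup e))
    (hmax : ∀ e, IsMaximalAbelian (𝒢.srcHom e).range ∧ IsMaximalAbelian (𝒢.tgtHom e).range)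
    (hnt : ∀ e, Nontrivial (𝒢.edgeGroup e)) {y : 𝒢.FundamentalGroup ∅} (hy : IsPath v v y)
    (hyv : y ∉ 𝒢.vertexGp v) :
    ∃ a, ∃ c ∈ edgeGp a, ∀ (m k : ℤ) (τ τ' : 𝒢.FundamentalGroup ∅ →* 𝒢.FundamentalGroup ∅),
      IsTwist a (c ^ m) τ → IsTwist a (c ^ k) τ' → τ y = τ' y → m = k := by
  classical
  obtain ⟨P, hP0⟩ := hy.exists_reducedPath hyv
  obtain ⟨n, a, h, U, hn, hU0, hU, hUn, hUpath, hinit, hh, hred, htail⟩ := P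
  simp only at hP0
  obtain ⟨s, hs, hs1⟩ : ∃ s ∈ edgeGp (bar (a 0)), s ≠ 1 := by
    have : ∀ b : 𝒢.E × Bool, ∃ s ∈ edgeGp b, s ≠ 1 := by
      rintro ⟨e, b⟩
      obtain ⟨c, hc⟩ := (nontrivial_iff_exists_ne (1 : 𝒢.edgeGroup e)).mp (hnt e)
      rcases b with _ | _
      · refine ⟨_, ⟨c, rfl⟩, fun h1 => hc ?_⟩
        exact ((ofVertex_empty_injective _).comp (𝒢.srcHom_injective e)) (by simpa using h1)
      · refine ⟨_, ⟨c, rfl⟩, fun h1 => hc ?_⟩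
        exact ((ofVertex_empty_injective _).comp (𝒢.tgtHom_injective e)) (by simpa using h1)
    exact this _
  obtain ⟨D, hDdef⟩ : ∃ D, D = U 0 * s * (U 0)⁻¹ := ⟨_, rfl⟩
  have hD1 : D ≠ 1 := by rwa [hDdef, Ne, conj_eq_one_iff]
  have hD : IsPath v v D := by
    have hsv := edgeGp_le_vertexGp _ hs
    rw [term_bar, hP0] at hsv
    rw [hDdef]
    exact .vertex (mul_mem (mul_mem hU0 hsv) (inv_mem hU0))
  have hgood0 : (U 0)⁻¹ * D * U 0 ∈ edgeGp (bar (a 0)) := by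
    have : (U 0)⁻¹ * D * U 0 = s := by rw [hDdef]; group
    rwa [this]
  -- The condition at i says that D fixes the i-th edge of the segment; `r` is the first index where
  -- this fails, or n if there is none.
  obtain ⟨r, hr0, hrn, hgood, hr⟩ : ∃ r, 0 < r ∧ r ≤ n ∧
      (∀ i < r, (U i)⁻¹ * D * U i ∈ edgeGp (bar (a i))) ∧
      (r < n → (U r)⁻¹ * D * U r ∉ edgeGp (bar (a r))) := by
    by_cases hex : ∃ i, i < n ∧ (U i)⁻¹ * D * U i ∉ edgeGp (bar (a i))
    · refine ⟨Nat.find hex, ?_, (Nat.find_spec hex).1.le, ?_, fun _ => (Nat.find_spec hex).2⟩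
      · rw [Nat.find_pos]
        exact fun h0 => h0.2 hgood0
      · intro i hi
        by_contra hc
        exact Nat.find_min hex hi ⟨hi.trans (Nat.find_spec hex).1, hc⟩
    · push Not at hex
      exact ⟨n, hn, le_rfl, hex, fun h => absurd h (lt_irrefl _)⟩
  have hgood' : ∀ i < r, (U i * letter (a i))⁻¹ * D * (U i * letter (a i)) ∈ edgeGp (a i) := by
    intro i hi
    have := letter_inv_conj_mem (hgood i hi)
    convert this using 1
    group
  have hUpath' : ∀ i < n, IsPath v (term (a i)) (U i * letter (a i)) := fun i hi =>
    (hUpath i hi).mul (isPath_letter _)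
  have hsame : ∀ i j, i < r → j < r → a j = a i → Commute (U j * (U i)⁻¹) D := by
    intro i j hi hj hij
    refine H.commute_mul_inv hab hD hD1 (hUpath i (by omega)) ?_ (hgood i hi) ?_
    · rw [← hij]
      exact hUpath j (by omega)
    · rw [← hij]
      exact hgood j hj
  have hopp : ∀ i j, i < r → j < r → a j = bar (a i) →
      IsPath v v (U j * letter (a j) * (U i)⁻¹) ∧
      Commute (U j * letter (a j) * (U i)⁻¹) D := by
    intro i j hi hj hij
    have hpath := hUpath' j (by omega)
    have hg := hgood' j hj
    have hterm : term (a j) = init (a i) := by rw [hij, term_bar]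
    rw [hterm] at hpath
    refine ⟨hpath.mul (hUpath i (by omega)).inv, ?_⟩
    refine H.commute_mul_inv hab hD hD1 (hUpath i (by omega)) hpath (hgood i hi) ?_
    rwa [← hij]
  obtain ⟨l, hl, hlne⟩ := FreeGroup.exists_forall_ne_inv (a := a)
    (f := fun i => 𝒢.toFreeGroup (U i)) hr0
    (by
      intro i hi
      simp only [hU i (by omega), map_mul, toFreeGroup_letter,
        toFreeGroup_vertex (hh i (by omega)), mul_one])
    (by
      intro i hi hbar
      refine hred i (by omega) hbar ?_
      rw [← inv_mem_iff]
      have hi' := hgood (i + 1) hi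
      rw [hbar] at hi'
      change _ ∈ edgeGp (bar (bar (a i))) at hi'
      rw [bar_bar] at hi'
      refine H.mem_edgeGp hab hmax (inv_mem (hh i (by omega))) (hgood' i (by omega)) ?_ ?_
      · intro h1
        exact hD1 ((conj_eq_one_iff (a := (U i * letter (a i))⁻¹)).mp (by rwa [inv_inv]))
      · convert hi' using 1
        rw [hU i (by omega)]
        group)
    (by
      intro i j k l hij hj hkl hl hbi hbk
      obtain ⟨h1, h2⟩ := hopp i j (by omega) hj hbi
      obtain ⟨h3, h4⟩ := hopp k l (by omega) hl hbk
      have := (H.commute_trans D _ _ hD h1 h3 hD1 h2.symm h4.symm).map 𝒢.toFreeGroup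
      simp only [hU j (by omega), hU l (by omega), map_mul, map_inv,
        toFreeGroup_vertex (hh j (by omega)), toFreeGroup_vertex (hh l (by omega)),
        mul_one] at this ⊢
      exact this)
  obtain ⟨c, hcdef⟩ : ∃ c, c = (U l * letter (a l))⁻¹ * D * (U l * letter (a l)) := ⟨_, rfl⟩
  have hc : c ∈ edgeGp (a l) := hcdef ▸ hgood' l hl
  let N : ℕ → ℤ := fun i => ∑ k ∈ Finset.range i, if a k = a l then 1 else 0
  have hN : 0 < N r := by
    refine Finset.sum_pos' (fun i _ => ?_) ⟨l, Finset.mem_range.mpr hl, by simp⟩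
    split_ifs <;> simp
  -- Each occurrence of a_l contributes the same factor D^m on the left, because the elements
  -- relating its occurrences commute with D. As its inverse never occurs before r, the
  -- contributions cannot cancel.
  have hτU : ∀ (m : ℤ) (τ : 𝒢.FundamentalGroup ∅ →* 𝒢.FundamentalGroup ∅),
      IsTwist (a l) (c ^ m) τ → ∀ i ≤ r, τ (U i) = D ^ (m * N i) * U i := by
    intro m τ hτ i
    induction i with
    | zero =>
      intro _
      simp [N, hτ.map_vertex _ _ hU0]
    | succ i ih =>
      intro hi
      rw [hU i (by omega), map_mul, map_mul, ih (by omega), hτ.map_vertex _ _ (hh i (by omega))]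
      by_cases hai : a i = a l
      · have hN1 : N (i + 1) = N i + 1 := by simp only [N, Finset.sum_range_succ, if_pos hai]
        have hcomm := hsame l i hl (by omega) hai
        have hconj : c ^ m = (U i * letter (a l))⁻¹ * D ^ m * (U i * letter (a l)) := by
          have h1 : c = (U i * letter (a l))⁻¹ * D * (U i * letter (a l)) := by
            have h2 : U i * letter (a l) = U i * (U l)⁻¹ * (U l * letter (a l)) := by group
            have h3 : (U i * (U l)⁻¹)⁻¹ * D * (U i * (U l)⁻¹) = D := by
              rw [mul_assoc, ← hcomm.eq]
              group
            rw [h2, hcdef]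
            conv_lhs => rw [← h3]
            group
          have h4 := conj_zpow (a := (U i * letter (a l))⁻¹) (b := D) (i := m)
          rw [inv_inv] at h4
          rw [h1, h4]
        rw [hai, hτ.map_letter, hconj, hN1, mul_add, mul_one, zpow_add]
        group
      · have hN1 : N (i + 1) = N i := by
          simp only [N, Finset.sum_range_succ, if_neg hai, add_zero]
        rw [hN1, hτ.map_letter_of_ne _ hai (hlne i (by omega))]
        group
  refine ⟨a l, c, hc, fun m k τ τ' hτ hτ' heq => ?_⟩
  by_contra hmk
  have hz : k * N r - m * N r ≠ 0 := by
    rw [← sub_mul]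
    exact mul_ne_zero (sub_ne_zero.mpr (Ne.symm hmk)) hN.ne'
  have hDz := H.zpow_ne_one D hD hD1 _ hz
  rcases Nat.lt_or_ge r n with hrlt | hrge
  · obtain ⟨M, hMred, hMv, hyM⟩ := htail r hrlt
    obtain ⟨L₁, hL₁, hL₁red, hL₁M, hL₁v⟩ := hτ.exists_map_eval (zpow_mem hc m) hMred hMv
    obtain ⟨L₂, hL₂, hL₂red, hL₂M, hL₂v⟩ := hτ'.exists_map_eval (zpow_mem hc k) hMred hMv
    have hX : (U r)⁻¹ * D * U r ∈ 𝒢.vertexGp (term (bar (a r))) := by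
      obtain ⟨r, rfl⟩ : ∃ r', r = r' + 1 := ⟨r - 1, by omega⟩
      rw [term_bar, hinit r hrlt]
      have h1 := edgeGp_le_vertexGp _ (hgood' r (by omega))
      have h2 := mul_mem (mul_mem (inv_mem (hh r (by omega))) h1) (hh r (by omega))
      convert h2 using 1
      rw [hU r (by omega)]
      group
    have hXz : (U r)⁻¹ * D ^ (k * N r - m * N r) * U r =
        ((U r)⁻¹ * D * U r) ^ (k * N r - m * N r) := by
      have h4 := conj_zpow (a := (U r)⁻¹) (b := D) (i := k * N r - m * N r)
      rw [inv_inv] at h4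
      exact h4.symm
    -- Equal images would make two twisted tails, both starting with the letter `a r`, differ by a
    -- conjugate of a nontrivial power of D.
    refine mul_eval_ne_eval (L := L₁) (M := L₂)
      (g := (U r)⁻¹ * D ^ (k * N r - m * N r) * U r)
      (fun x hx => vertexGp_le_range_ofBase _ (hL₁v x hx))
      (fun x hx => vertexGp_le_range_ofBase _ (hL₂v x hx))
      (hXz ▸ vertexGp_le_range_ofBase _ (zpow_mem hX _)) hL₁red hL₂red ?_ ?_ ?_
    · rintro rfl
      simp at hL₂M
    · intro x hx y _ _ hmem
      have hxr : x.1 = a r := by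
        cases L₁ with
        | nil => simp at hx
        | cons z L =>
          simp only [List.head?_cons, Option.mem_def, Option.some.injEq] at hx
          subst hx
          simp only [List.map_cons, List.cons.injEq] at hL₁M
          exact hL₁M.1
      rw [hxr] at hmem
      -- The conjugate of D commutes with its own power; if that power lay in the edge group,
      -- malnormality would put the conjugate itself there, against the choice of `r`.
      refine hr hrlt (H.mem_edgeGp hab hmax hX hmem ?_ ?_)
      · intro h1
        exact hDz ((conj_eq_one_iff (a := (U r)⁻¹)).mp (by rwa [inv_inv]))
      · rw [hXz] at hmem ⊢
        rwa [← zpow_one_add, add_comm, zpow_add_one, mul_inv_cancel_right]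
    · rw [hyM, map_mul, map_mul, hτU m τ hτ r le_rfl, hτU k τ' hτ' r le_rfl, hL₁, hL₂] at heq
      have : (eval L₁)⁻¹ * ((U r)⁻¹ * D ^ (k * N r - m * N r) * U r) * eval L₂ =
          (D ^ (m * N r) * U r * eval L₁)⁻¹ * (D ^ (k * N r) * U r * eval L₂) := by
        rw [sub_eq_neg_add, zpow_add, zpow_neg]
        group
      rw [this, heq, inv_mul_cancel]
      exact one_mem _
  · have hrn' : r = n := le_antisymm hrn hrge
    rw [← hUn, ← hrn', hτU m τ hτ r le_rfl, hτU k τ' hτ' r le_rfl, mul_left_inj] at heq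
    apply hDz
    rw [zpow_sub, heq, mul_inv_cancel]

end Core

end GraphOfGroups

/-! ### Commutation and conjugacy in torsion-free CSA groups. -/

section CSA

variable {G : Type*} [Group G]

/-- Every commutative subgroup is contained in a maximal abelian subgroup. -/
theorem exists_isMaximalAbelian_ge (K : Subgroup G) (hK : IsMulCommutative K) :
    ∃ M, K ≤ M ∧ IsMaximalAbelian M := by
  refine zorn_le_nonempty₀ {K : Subgroup G | IsMulCommutative K} ?_ K hK
  intro c hc hchain y hy
  refine ⟨sSup c, ⟨⟨?_⟩⟩, fun z hz => le_sSup hz⟩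
  rintro ⟨a, ha⟩ ⟨b, hb⟩
  obtain ⟨P, hP, haP⟩ := (Subgroup.mem_sSup_of_directedOn ⟨y, hy⟩ hchain.directedOn).mp ha
  obtain ⟨Q, hQ, hbQ⟩ := (Subgroup.mem_sSup_of_directedOn ⟨y, hy⟩ hchain.directedOn).mp hb
  obtain ⟨R, hR, hPR, hQR⟩ := hchain.directedOn P hP Q hQ
  have hcomm : IsMulCommutative R := hc hR
  have hab : a * b = b * a := congrArg Subtype.val
    (hcomm.is_comm.comm (⟨a, hPR haP⟩ : R) ⟨b, hQR hbQ⟩)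
  exact Subtype.ext hab

theorem exists_isMaximalAbelian_mem {x y : G} (h : Commute x y) :
    ∃ M : Subgroup G, x ∈ M ∧ y ∈ M ∧ IsMaximalAbelian M := by
  have hK : IsMulCommutative (Subgroup.closure {x, y}) := by
    apply Subgroup.isMulCommutative_closure
    rintro a (rfl | rfl) b (rfl | rfl)
    · rfl
    · exact h.eq
    · exact h.symm.eq
    · rfl
  obtain ⟨M, hM, hmax⟩ := exists_isMaximalAbelian_ge _ hK
  exact ⟨M, hM (Subgroup.subset_closure (by simp)), hM (Subgroup.subset_closure (by simp)), hmax⟩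

theorem IsMaximalAbelian.commute {M : Subgroup G} (hM : IsMaximalAbelian M) {x y : G}
    (hx : x ∈ M) (hy : y ∈ M) : Commute x y :=
  congrArg Subtype.val (hM.prop.is_comm.comm (⟨x, hx⟩ : M) ⟨y, hy⟩)

theorem IsMalnormal.mem_of_conj_mem {M : Subgroup G} (hM : IsMalnormal M) {D g : G} (hD1 : D ≠ 1)
    (hD : D ∈ M) (hg : g * D * g⁻¹ ∈ M) : g ∈ M := by
  by_contra hgM
  have h : g * D * g⁻¹ ∈ M ⊓ conjSubgroup g M := ⟨hg, ⟨D, hD, rfl⟩⟩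
  rw [hM g hgM, Subgroup.mem_bot, conj_eq_one_iff] at h
  exact hD1 h

theorem IsCSA.commute_of_conj (hG : IsCSA G) {D g : G} (hD1 : D ≠ 1)
    (h : Commute D (g * D * g⁻¹)) : Commute g D := by
  obtain ⟨M, hD, hg, hM⟩ := exists_isMaximalAbelian_mem h
  exact hM.commute ((hG M hM).mem_of_conj_mem hD1 hD hg) hD

theorem IsCSA.commute_trans (hG : IsCSA G) {D x y : G} (hD1 : D ≠ 1) (hx : Commute D x)
    (hy : Commute D y) : Commute x y := by
  obtain ⟨M, hD, hxM, hM⟩ := exists_isMaximalAbelian_mem hx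
  refine hM.commute hxM ((hG M hM).mem_of_conj_mem hD1 hD ?_)
  rwa [← hy.eq, mul_inv_cancel_right]

theorem IsTorsionFreeGroup.zpow_ne_one (hG : IsTorsionFreeGroup G) {g : G} (hg : g ≠ 1) {z : ℤ}
    (hz : z ≠ 0) : g ^ z ≠ 1 := fun h =>
  hG g hg (isOfFinOrder_iff_zpow_eq_one.mpr ⟨z, hz, h⟩)

/-- In a noncommutative torsion-free CSA group nontrivial conjugacy classes are infinite. -/
theorem IsCSA.commute_of_finite_conj (hG : IsCSA G) (htf : IsTorsionFreeGroup G) {x : G}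
    (hx1 : x ≠ 1) (hx : {y | ∃ g : G, g * x * g⁻¹ = y}.Finite) (a b : G) : Commute a b := by
  have hcentral : ∀ g, Commute x g := by
    intro g
    by_cases hg : g = 1
    · rw [hg]
      exact Commute.one_right x
    -- By the pigeonhole principle a nonzero power of g commutes with x; this power is nontrivial
    -- and commutes with g, so commutative transitivity gives that x and g commute.
    obtain ⟨m, k, hmk, h⟩ : ∃ m k : ℤ, m ≠ k ∧ g ^ m * x * (g ^ m)⁻¹ = g ^ k * x * (g ^ k)⁻¹ := by
      by_contra hne
      push Not at hne
      refine hx.not_infinite (Set.infinite_of_injective_forall_mem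
        (f := fun m : ℤ => g ^ m * x * (g ^ m)⁻¹) ?_ fun m => ⟨g ^ m, rfl⟩)
      intro m k h
      by_contra hmk
      exact hne m k hmk h
    have hz : m - k ≠ 0 := sub_ne_zero.mpr hmk
    have hcomm : Commute (g ^ (m - k)) x := by
      rw [Commute, SemiconjBy, sub_eq_neg_add, zpow_add, zpow_neg]
      have h' : g ^ m * x = g ^ k * x * (g ^ k)⁻¹ * g ^ m := by
        rw [← h, inv_mul_cancel_right]
      rw [mul_assoc, h']
      group
    exact hG.commute_trans (htf.zpow_ne_one hg hz) hcomm ((Commute.refl g).zpow_left _)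
  exact hG.commute_trans hx1 (hcentral a) (hcentral b)

end CSA

/-! ### Definable sets, automorphisms and conjugation. -/

section AlgebraicClosure

variable {G : Type*} [Group G]

/-- A group automorphism as an automorphism of the structure in the language of groups. -/
def MulEquiv.toGroupLanguageEquiv (f : G ≃* G) : groupLanguage.Equiv G G where
  toEquiv := f.toEquiv
  map_fun' := by
    rintro _ (_ | _ | _) x
    · exact map_one f
    · exact map_inv f _
    · exact map_mul f _ _
  map_rel' := by
    rintro _ r
    exact r.elim

theorem acl_subset_racl (A : Set G) : acl A ⊆ racl A := by
  rintro x ⟨S, hS, hfin, hx⟩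
  refine hfin.subset ?_
  rintro _ ⟨f, hf, rfl⟩
  obtain ⟨φ, hφ⟩ := Set.definable_iff_exists_formula_sum.mp hS
  have hmem : ∀ y, y ∈ S ↔ φ.Realize (Sum.elim (fun a : A => (a : G)) fun _ : Fin 1 => y) := by
    intro y
    have h := Set.ext_iff.mp hφ fun _ => y
    exact h
  rw [hmem] at hx ⊢
  rw [← FirstOrder.Language.StrongHomClass.realize_formula f.toGroupLanguageEquiv] at hx
  convert hx using 1
  funext i
  rcases i with a | i
  · exact (hf a a.2).symm
  · rfl

/-- An automorphism fixing `H` pointwise becomes, after conjugation by `g`, one fixing `A`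
pointwise. This reduces the theorem to vertex groups themselves. -/
theorem racl_subset_conjSubgroup {A H : Subgroup G} {g : G} (hA : A ≤ conjSubgroup g H)
    (hH : racl (H : Set G) ⊆ H) : racl (A : Set G) ⊆ conjSubgroup g H := by
  intro x hx
  have hconj : g⁻¹ * x * g ∈ racl (H : Set G) := by
    refine (Set.Finite.image (fun y => g⁻¹ * y * g) hx).subset ?_
    rintro _ ⟨f, hf, rfl⟩
    refine ⟨g * f (g⁻¹ * x * g) * g⁻¹,
      ⟨((MulAut.conj g).symm.trans f).trans (MulAut.conj g), ?_, ?_⟩, ?_⟩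
    · intro a ha
      obtain ⟨h, hh, rfl⟩ := hA ha
      have hgh : g⁻¹ * (g * h * g⁻¹) * g = h := by group
      show g * f (g⁻¹ * (g * h * g⁻¹) * g) * g⁻¹ = g * h * g⁻¹
      rw [hgh, hf h hh]
    · simp
    · simp only
      group
  refine ⟨g⁻¹ * x * g, hH hconj, ?_⟩
  simp only [MulEquiv.toMonoidHom_eq_coe, MonoidHom.coe_coe, MulAut.conj_apply]
  group

end AlgebraicClosure

/-! ### Graphs of groups with a trivial edge group. -/

namespace GraphOfGroups

variable {𝒢 : GraphOfGroups.{u₁, u₂, u₃, u₄}}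

/-- The trivial subgroup commutes with everything, so it is maximal abelian only in the trivial
group. Triviality thus spreads along edges. -/
theorem subsingleton_vertexGroup_iff
    (hmax : ∀ e, IsMaximalAbelian (𝒢.srcHom e).range ∧ IsMaximalAbelian (𝒢.tgtHom e).range)
    (e : 𝒢.E) : (Subsingleton (𝒢.vertexGroup (𝒢.src e)) ↔ Subsingleton (𝒢.edgeGroup e)) ∧
      (Subsingleton (𝒢.vertexGroup (𝒢.tgt e)) ↔ Subsingleton (𝒢.edgeGroup e)) := by
  have key : ∀ {C K : Type _} [Group C] [Group K] (f : C →* K), Function.Injective f →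
      IsMaximalAbelian f.range → (Subsingleton K ↔ Subsingleton C) := by
    intro C K _ _ f hf hmax
    refine ⟨fun _ => hf.subsingleton, fun hC => ?_⟩
    have h1 : ∀ x : K, x = 1 := by
      intro x
      obtain ⟨c, rfl⟩ : x ∈ f.range := hmax.mem_of_commute (by
        rintro _ ⟨c, rfl⟩
        rw [Subsingleton.elim c 1, map_one]
        exact Commute.one_right x)
      rw [Subsingleton.elim c 1, map_one]
    exact ⟨fun x y => (h1 x).trans (h1 y).symm⟩
  exact ⟨key _ (𝒢.srcHom_injective e) (hmax e).1, key _ (𝒢.tgtHom_injective e) (hmax e).2⟩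

theorem IsPath.subsingleton_iff
    (hmax : ∀ e, IsMaximalAbelian (𝒢.srcHom e).range ∧ IsMaximalAbelian (𝒢.tgtHom e).range)
    {u w : 𝒢.V} {p : 𝒢.FundamentalGroup ∅} (hp : IsPath u w p) :
    Subsingleton (𝒢.vertexGroup u) ↔ Subsingleton (𝒢.vertexGroup w) := by
  induction hp with
  | vertex => rfl
  | @cons w a h p hh _ ih =>
    rw [← ih]
    obtain ⟨h1, h2⟩ := subsingleton_vertexGroup_iff hmax a.1
    rcases a with ⟨e, _ | _⟩
    · exact h2.trans h1.symm
    · exact h1.trans h2.symm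

/-- If the vertex groups are trivial and the fundamental group is commutative, then the fundamental
group is cyclic. -/
theorem isCyclic_of_subsingleton_of_commute {T : Set 𝒢.E}
    (htriv : ∀ w, Subsingleton (𝒢.vertexGroup w))
    (hcomm : ∀ a b : 𝒢.FundamentalGroup T, Commute a b) : IsCyclic (𝒢.FundamentalGroup T) := by
  classical
  have hv : ∀ w x, 𝒢.ofVertex T w x = 1 := fun w x => by
    rw [Subsingleton.elim x 1, map_one]
  -- Two edges outside the tree could be sent to two noncommuting transpositions of three points.
  have huniq : ∀ e e', e ∉ T → e' ∉ T → e = e' := by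
    intro e e' he he'
    by_contra hne
    let f : 𝒢.FundamentalGroup T →* Equiv.Perm (Fin 3) :=
      liftHom (fun _ => 1) (fun d => if d = e then Equiv.swap 0 1 else
        if d = e' then Equiv.swap 1 2 else 1) (fun d c => by simp) (fun d hd => by
          rw [if_neg (by rintro rfl; exact he hd), if_neg (by rintro rfl; exact he' hd)])
    have h := (hcomm (𝒢.edgeElt T e) (𝒢.edgeElt T e')).map f
    simp only [f, liftHom_edgeElt, if_true, if_neg (Ne.symm hne)] at h
    exact absurd h.eq (by decide)
  by_cases hex : ∃ e, e ∉ T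
  · obtain ⟨e₀, he₀⟩ := hex
    have htop : Subgroup.zpowers (𝒢.edgeElt T e₀) = ⊤ := by
      apply eq_top_of_generators
      · intro w x
        rw [hv]
        exact one_mem _
      · intro e
        by_cases he : e ∈ T
        · rw [𝒢.edgeElt_eq_one T he]
          exact one_mem _
        · rw [huniq e e₀ he he₀]
          exact Subgroup.mem_zpowers _
    exact ⟨𝒢.edgeElt T e₀, fun x => Subgroup.mem_zpowers_iff.mp (htop.ge (Subgroup.mem_top x))⟩
  · push Not at hex
    have htop : Subgroup.zpowers (1 : 𝒢.FundamentalGroup T) = ⊤ := by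
      apply eq_top_of_generators
      · intro w x
        rw [hv]
        exact one_mem _
      · intro e
        rw [𝒢.edgeElt_eq_one T (hex e)]
        exact one_mem _
    exact ⟨1, fun x => Subgroup.mem_zpowers_iff.mp (htop.ge (Subgroup.mem_top x))⟩

end GraphOfGroups

/-! ### Transfer to G and conclusion. -/

namespace Splitting

open GraphOfGroups

variable {G : Type*} [Group G] {Λ : Splitting.{u₁, u₂, u₃, u₄} G}

/-- The map to G is injective on loops at `v`, so commutation and orders of loops can be tested in
G. -/
theorem pathCSA (htf : IsTorsionFreeGroup G) (hcsa : IsCSA G) (v : Λ.graph.V) :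
    PathCSA v := by
  obtain ⟨hconn, ψ, -, -, hψ⟩ := exists_section Λ.isMaximalSubtree v
  let θ : Λ.graph.FundamentalGroup ∅ →* G := Λ.iso.symm.toMonoidHom.comp (collapse Λ.tree)
  have hθ : ∀ p q, IsPath v v p → IsPath v v q → θ p = θ q → p = q := by
    intro p q hp hq h
    have h' : collapse Λ.tree p = collapse Λ.tree q := Λ.iso.symm.injective h
    rw [← hψ p hp, h', hψ q hq]
  have hθ1 : ∀ p, IsPath v v p → p ≠ 1 → θ p ≠ 1 := by
    intro p hp hp1 h
    exact hp1 (hθ p 1 hp (.one v) (by rw [h, map_one]))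
  have hθc : ∀ p q, IsPath v v p → IsPath v v q → Commute (θ p) (θ q) → Commute p q := by
    intro p q hp hq h
    refine hθ _ _ (hp.mul hq) (hq.mul hp) ?_
    rw [map_mul, map_mul, h.eq]
  refine ⟨?_, ?_, ?_, hconn⟩
  · intro D g hD hg hD1 h
    refine hθc _ _ hg hD (hcsa.commute_of_conj (hθ1 D hD hD1) ?_)
    simpa using h.map θ
  · intro D x y hD hx hy hD1 h1 h2
    exact hθc _ _ hx hy (hcsa.commute_trans (hθ1 D hD hD1) (h1.map θ) (h2.map θ))
  · intro D hD hD1 z hz h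
    refine htf.zpow_ne_one (hθ1 D hD hD1) hz ?_
    rw [← map_zpow, h, map_one]

/-- Twists preserve loops at `v`, so through the section they induce automorphisms of G, the inverse
being the twist by the opposite power. They fix the vertex group and take infinitely many values at
an element outside it. -/
theorem racl_vertexSubgroup_subset_of_nontrivial (htf : IsTorsionFreeGroup G) (hcsa : IsCSA G)
    (hab : ∀ e, IsMulCommutative (Λ.graph.edgeGroup e)) (hmax : Λ.EdgeGroupsMaximalAbelian)
    (hnt : ∀ e, Nontrivial (Λ.graph.edgeGroup e)) (v : Λ.graph.V) :
    racl (Λ.vertexSubgroup v : Set G) ⊆ Λ.vertexSubgroup v := by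
  intro x hx
  by_contra hxv
  obtain ⟨-, ψ, hψ, hψpath, hψc⟩ := exists_section Λ.isMaximalSubtree v
  have hyv : ψ (Λ.iso x) ∉ Λ.graph.vertexGp v := by
    rintro ⟨z, hz⟩
    refine hxv ⟨z, ?_⟩
    have h := hψ (Λ.iso x)
    rw [← hz, collapse_ofVertex] at h
    simp [h]
  obtain ⟨a, c, hc, hinj⟩ := (pathCSA htf hcsa v).exists_twist_injective hab hmax hnt
    (hψpath (Λ.iso x)) hyv
  choose τ hτ using fun m : ℤ => exists_isTwist hab (zpow_mem hc m)
  let F : ℤ → Λ.graph.FundamentalGroup Λ.tree →* Λ.graph.FundamentalGroup Λ.tree :=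
    fun m => (collapse Λ.tree).comp ((τ m).comp ψ)
  have hF : ∀ m, (F (-m)).comp (F m) = MonoidHom.id _ := by
    intro m
    refine MonoidHom.ext fun z => ?_
    have hσ : IsTwist a (c ^ m)⁻¹ (τ (-m)) := by
      rw [← zpow_neg]
      exact hτ (-m)
    simp only [F, MonoidHom.comp_apply, MonoidHom.id_apply]
    rw [hψc _ ((hτ m).isPath_map (zpow_mem hc m) (hψpath z)),
      (hτ m).comp_inv (zpow_mem hc m) hσ, hψ]
  let f : ℤ → G ≃* G := fun m =>
    (Λ.iso.trans ((F m).toMulEquiv (F (-m)) (hF m) (by simpa using hF (-m)))).trans Λ.iso.symm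
  have hf : ∀ m z, f m z = Λ.iso.symm (collapse Λ.tree (τ m (ψ (Λ.iso z)))) := fun m z => rfl
  refine Set.infinite_of_injective_forall_mem (f := fun m : ℤ => f m x) ?_ ?_ hx
  · intro m k h
    simp only [hf, EmbeddingLike.apply_eq_iff_eq] at h
    refine hinj m k _ _ (hτ m) (hτ k) ?_
    rw [← hψc _ ((hτ m).isPath_map (zpow_mem hc m) (hψpath (Λ.iso x))), h,
      hψc _ ((hτ k).isPath_map (zpow_mem hc k) (hψpath (Λ.iso x)))]
  · intro m
    refine ⟨f m, ?_, rfl⟩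
    rintro _ ⟨z, rfl⟩
    have hz : Λ.graph.ofVertex ∅ v z ∈ Λ.graph.vertexGp v := ⟨z, rfl⟩
    rw [hf]
    simp only [MonoidHom.comp_apply, MulEquiv.toMonoidHom_eq_coe, MonoidHom.coe_coe,
      MulEquiv.apply_symm_apply]
    rw [← collapse_ofVertex, hψc _ (.vertex hz), (hτ m).map_vertex v _ hz]

theorem racl_vertexSubgroup_subset (htf : IsTorsionFreeGroup G) (hcsa : IsCSA G)
    (hab : ∀ e, IsMulCommutative (Λ.graph.edgeGroup e)) (hmax : Λ.EdgeGroupsMaximalAbelian)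
    (hedge : Infinite G → IsCyclic G → ∀ e, Nontrivial (Λ.graph.edgeGroup e)) (v : Λ.graph.V) :
    racl (Λ.vertexSubgroup v : Set G) ⊆ Λ.vertexSubgroup v := by
  by_cases hnt : ∀ e, Nontrivial (Λ.graph.edgeGroup e)
  · exact racl_vertexSubgroup_subset_of_nontrivial htf hcsa hab hmax hnt v
  intro x hx
  by_cases hx1 : x = 1
  · rw [hx1]
    exact one_mem _
  refine absurd (hedge ?_ ?_) hnt
  · by_contra hfin
    rw [not_infinite_iff_finite] at hfin
    exact htf x hx1 (isOfFinOrder_of_finite x)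
  · push Not at hnt
    obtain ⟨e, he⟩ := hnt
    obtain ⟨hconn, -⟩ := exists_section Λ.isMaximalSubtree (Λ.graph.src e)
    have htriv : ∀ w, Subsingleton (Λ.graph.vertexGroup w) := by
      intro w
      obtain ⟨γ, hγ⟩ := hconn w
      exact (hγ.subsingleton_iff hmax).mp ((subsingleton_vertexGroup_iff hmax e).1.mpr he)
    -- The vertex group is trivial, so inner automorphisms fix it pointwise and the conjugacy class
    -- of `x` is finite.
    have hcomm := hcsa.commute_of_finite_conj htf hx1 (hx.subset (by
      rintro _ ⟨g, rfl⟩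
      refine ⟨MulAut.conj g, ?_, rfl⟩
      rintro _ ⟨z, rfl⟩
      have := htriv v
      rw [Subsingleton.elim z 1, map_one, map_one]))
    have hcyc : IsCyclic (Λ.graph.FundamentalGroup Λ.tree) :=
      isCyclic_of_subsingleton_of_commute htriv fun a b => by
        simpa using (hcomm (Λ.iso.symm a) (Λ.iso.symm b)).map Λ.iso
    exact isCyclic_of_surjective Λ.iso.symm Λ.iso.symm.surjective

end Splitting

theorem mainTheorem11 {G : Type*} [Group G] (htf : IsTorsionFreeGroup G) (hcsa : IsCSA G)
    (A : Subgroup G) (Λ : Splitting.{u₁, u₂, u₃, u₄} G)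
    (hΛ : Λ.IsAbelianRelativeTo A) (hmax : Λ.EdgeGroupsMaximalAbelian)
    (hedge : Infinite G → IsCyclic G → ∀ e, Nontrivial (Λ.graph.edgeGroup e))
    (v : Λ.graph.V) (g : G) (hA : A ≤ conjSubgroup g (Λ.vertexSubgroup v)) :
    racl (A : Set G) ⊆ conjSubgroup g (Λ.vertexSubgroup v) ∧
      acl (A : Set G) ⊆ conjSubgroup g (Λ.vertexSubgroup v) := by
  have h := racl_subset_conjSubgroup hA
    (Splitting.racl_vertexSubgroup_subset htf hcsa hΛ.abelian hmax hedge v)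
  exact ⟨h, (acl_subset_racl _).trans h⟩
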